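/- Let $(M,g)$ be a nonempty smooth Riemannian manifold of dimension $n\ge 2$ with constant sectional curvature $c\neq 0$, and let $A>0$ be a real constant. Let $\nabla$ be the Levi-Civita connection of $g$, with Christoffel symbols $\Gamma^k_{ij}$. On the cotangent bundle $T^*M$, in the local coordinates $(q^i,p_i)$ induced by local coordinates on $M$ (summation convention), put $$\|p\|^2=g^{ij}p_ip_j,\qquad t=\tfrac12\|p\|^2,\qquad g^{0i}=p_hg^{hi},\qquad \Gamma^0_{ij}=p_k\Gamma^k_{ij},$$ $$\frac{\delta}{\delta q^i}=\frac{\partial}{\partial q^i}+\Gamma^0_{ih}\frac{\partial}{\partial p_h},\qquad Dp_i=dp_i-\Gamma^0_{ij}\,dq^j,$$ $$G_{ij}=A\,g_{ij}-\frac cA\,p_ip_j,\qquad H^{ij}=\frac1A\,g^{ij}+\frac{c}{A(A^2-2ct)}\,g^{0i}g^{0j},$$ and define the Riemannian metric $G$ and the almost complex structure $J$ by $$G=G_{ij}\,dq^i\,dq^j+H^{ij}\,Dp_i\,Dp_j,\qquad J\frac{\delta}{\delta q^i}=G_{ik}\frac{\partial}{\partial p_k},\qquad J\frac{\partial}{\partial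 p_i}=-H^{ik}\frac{\delta}{\delta q^k},$$ on the whole of $T^*M$ if $c<0$, and on the tube $T^*_AM=\{p\in T^*M:\ \|p\|^2<A^2/c\}$ around the zero section if $c>0$. The holomorphic sectional curvature of $(G,J)$ in the direction of a tangent vector $X\neq0$ is the sectional curvature of $G$ on the plane spanned by $X$ and $JX$. 1. If $c<0$, then $(T^*M,G,J)$ does not have constant holomorphic sectional curvature. 2. If $c>0$, then $(T^*_AM,G,J)$ does not have constant holomorphic sectional curvature. That is, in neither case is there a real number $k$ such that the holomorphic sectional curvature equals $k$ at every point and in the direction of every nonzero tangent vector. -/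

import Mathlib

open scoped Manifold ContDiff

noncomputable section

namespace CotangentKahler

/-! ### Riemannian geometry in a chart

A Riemannian metric on an open piece of `ℝ^ι` is given by its matrix of components, a function
`h : (ι → ℝ) → Matrix ι ι ℝ` of the coordinates. -/

section Local

variable {ι : Type*} [Fintype ι] [DecidableEq ι]

/-- The partial derivative `∂f/∂y^i`. -/
def partialDeriv (i : ι) (f : (ι → ℝ) → ℝ) (y : ι → ℝ) : ℝ :=
  fderiv ℝ f y (Pi.single i 1)

/-- The Christoffel symbols `Γ^k_{ij}` of the Levi-Civita connection of `h` at `y`. -/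
def christoffel (h : (ι → ℝ) → Matrix ι ι ℝ) (y : ι → ℝ) (k i j : ι) : ℝ :=
  (1 / 2 : ℝ) * ∑ l, (h y)⁻¹ k l *
    (partialDeriv i (fun z => h z j l) y + partialDeriv j (fun z => h z i l) y
      - partialDeriv l (fun z => h z i j) y)

/-- The components `R^l_{kij}` of the curvature tensor
`K(X, Y) Z = ∇_X ∇_Y Z - ∇_Y ∇_X Z - ∇_[X,Y] Z` of `h`:
`K(∂_i, ∂_j) ∂_k = R^l_{kij} ∂_l`. -/
def curvature (h : (ι → ℝ) → Matrix ι ι ℝ) (y : ι → ℝ) (l k i j : ι) : ℝ :=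
  partialDeriv i (fun z => christoffel h z l j k) y
    - partialDeriv j (fun z => christoffel h z l i k) y
    + ∑ m, (christoffel h y l i m * christoffel h y m j k
        - christoffel h y l j m * christoffel h y m i k)

/-- The scalar product `h_y(u, v) = h_{ij}(y) u^i v^j`. -/
def pairing (h : (ι → ℝ) → Matrix ι ι ℝ) (y u v : ι → ℝ) : ℝ :=
  ∑ i, ∑ j, h y i j * u i * v j

/-- The vector `K(u, v) w`. -/
def curvatureVec (h : (ι → ℝ) → Matrix ι ι ℝ) (y u v w : ι → ℝ) : ι → ℝ :=
  fun l => ∑ i, ∑ j, ∑ k, curvature h y l k i j * u i * v j * w k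

/-- The sectional curvature `h(K(u, v) v, u) / (h(u, u) h(v, v) - h(u, v)²)` at `y` of the plane
spanned by `u` and `v`. -/
def sectionalCurvature (h : (ι → ℝ) → Matrix ι ι ℝ) (y u v : ι → ℝ) : ℝ :=
  pairing h y (curvatureVec h y u v v) u
    / (pairing h y u u * pairing h y v v - pairing h y u v ^ 2)

end Local

/-! ### The natural diagonal structure on the cotangent bundle, in an induced chart

A chart of the base with coordinates `q^i` induces a chart of the cotangent bundle with coordinates
`(q^i, p_i)`. These are indexed by `ι ⊕ ι`: `Sum.inl i` is the index of `q^i`, and `Sum.inr i` is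
the index of `p_i`. Below, `g` is the matrix of components of the metric of the base, `A` is a
real constant and `v` is a real function of the energy density. -/

section Induced

variable {ι : Type*} [Fintype ι] [DecidableEq ι]

/-- The coordinates `q^i` of a point of the cotangent bundle. -/
def posn (z : ι ⊕ ι → ℝ) : ι → ℝ := fun i => z (Sum.inl i)

/-- The coordinates `p_i` of a point of the cotangent bundle. -/
def mom (z : ι ⊕ ι → ℝ) : ι → ℝ := fun i => z (Sum.inr i)

/-- `g^{0i} = p_h g^{hi}`. -/
def raisedMom (g : (ι → ℝ) → Matrix ι ι ℝ) (z : ι ⊕ ι → ℝ) (i : ι) : ℝ :=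
  ∑ h, mom z h * (g (posn z))⁻¹ h i

/-- The energy density `t = ½ g^{ik} p_i p_k`. -/
def energyDensity (g : (ι → ℝ) → Matrix ι ι ℝ) (z : ι ⊕ ι → ℝ) : ℝ :=
  (1 / 2 : ℝ) * ∑ i, ∑ k, (g (posn z))⁻¹ i k * mom z i * mom z k

/-- `G_{ij} = A g_{ij} + v(t) p_i p_j`. -/
def lowerG (g : (ι → ℝ) → Matrix ι ι ℝ) (A : ℝ) (v : ℝ → ℝ) (z : ι ⊕ ι → ℝ) (i j : ι) : ℝ :=
  A * g (posn z) i j + v (energyDensity g z) * mom z i * mom z j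

/-- The function `w = - v / (A (A + 2 t v))`. -/
def auxW (A : ℝ) (v : ℝ → ℝ) (t : ℝ) : ℝ := -(v t) / (A * (A + 2 * t * v t))

/-- `H^{kl} = A⁻¹ g^{kl} + w(t) g^{0k} g^{0l}`; this is the inverse of the matrix `G_{ij}`. -/
def upperH (g : (ι → ℝ) → Matrix ι ι ℝ) (A : ℝ) (v : ℝ → ℝ) (z : ι ⊕ ι → ℝ) (k l : ι) : ℝ :=
  1 / A * (g (posn z))⁻¹ k l
    + auxW A v (energyDensity g z) * raisedMom g z k * raisedMom g z l

/-- `Γ⁰_{ih} = p_k Γ^k_{ih}`. -/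
def christoffelZero (g : (ι → ℝ) → Matrix ι ι ℝ) (z : ι ⊕ ι → ℝ) (i h : ι) : ℝ :=
  ∑ k, mom z k * christoffel g (posn z) k i h

/-- The absolute differential `Dp_i = dp_i - Γ⁰_{ij} dq^j`, evaluated on a tangent vector `X`. -/
def absDiff (g : (ι → ℝ) → Matrix ι ι ℝ) (z : ι ⊕ ι → ℝ) (i : ι) (X : ι ⊕ ι → ℝ) : ℝ :=
  X (Sum.inr i) - ∑ j, christoffelZero g z i j * X (Sum.inl j)

/-- The vertical vector field `∂/∂p_i`. -/
def vertField (i : ι) : ι ⊕ ι → ℝ := Pi.single (Sum.inr i) 1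

/-- The horizontal vector field `δ/δq^i = ∂/∂q^i + Γ⁰_{ih} ∂/∂p_h`. -/
def horField (g : (ι → ℝ) → Matrix ι ι ℝ) (z : ι ⊕ ι → ℝ) (i : ι) : ι ⊕ ι → ℝ :=
  Pi.single (Sum.inl i) 1 + ∑ h, christoffelZero g z i h • vertField h

/-- The metric `G = G_{ij} dq^i dq^j + H^{ij} Dp_i Dp_j` on tangent vectors of the cotangent
bundle. -/
def cotangentForm (g : (ι → ℝ) → Matrix ι ι ℝ) (A : ℝ) (v : ℝ → ℝ) (z X Y : ι ⊕ ι → ℝ) : ℝ :=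
  ∑ i, ∑ j, lowerG g A v z i j * X (Sum.inl i) * Y (Sum.inl j)
    + ∑ i, ∑ j, upperH g A v z i j * absDiff g z i X * absDiff g z j Y

/-- The matrix of components of `G` with respect to the coordinates `(q, p)`. -/
def cotangentMetric (g : (ι → ℝ) → Matrix ι ι ℝ) (A : ℝ) (v : ℝ → ℝ) (z : ι ⊕ ι → ℝ) :
    Matrix (ι ⊕ ι) (ι ⊕ ι) ℝ :=
  Matrix.of fun a b => cotangentForm g A v z (Pi.single a 1) (Pi.single b 1)

/-- The almost complex structure `J δ/δq^i = G_{ik} ∂/∂p_k`, `J ∂/∂p_i = - H^{ik} δ/δq^k`, applied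
to `X = dq^i(X) δ/δq^i + Dp_i(X) ∂/∂p_i`. -/
def cotangentJ (g : (ι → ℝ) → Matrix ι ι ℝ) (A : ℝ) (v : ℝ → ℝ) (z X : ι ⊕ ι → ℝ) :
    ι ⊕ ι → ℝ :=
  ∑ i, ∑ k, (X (Sum.inl i) * lowerG g A v z i k) • vertField k
    - ∑ i, ∑ k, (absDiff g z i X * upperH g A v z i k) • horField g z k

/-- The holomorphic sectional curvature of `(G, J)` at `z` in the direction `X ≠ 0`: the sectional
curvature of `G` on the plane spanned by `X` and `J X`. -/
def holomorphicSectionalCurvature (g : (ι → ℝ) → Matrix ι ι ℝ) (A : ℝ) (v : ℝ → ℝ)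
    (z X : ι ⊕ ι → ℝ) : ℝ :=
  sectionalCurvature (cotangentMetric g A v) z X (cotangentJ g A v z X)

end Induced

/-! ### Manifolds -/

section Global

/-- Smooth Riemannian metrics on the `n`-dimensional manifold `M`. -/
abbrev SmoothMetric (n : ℕ) (M : Type*) [TopologicalSpace M]
    [ChartedSpace (EuclideanSpace ℝ (Fin n)) M] [IsManifold (𝓡 n) ∞ M] :=
  Bundle.ContMDiffRiemannianMetric (𝓡 n) ∞ (EuclideanSpace ℝ (Fin n))
    (fun x : M => TangentSpace (𝓡 n) x)

/-- The cotangent bundle `T*M`: pairs of a point `x` of `M` and a covector at `x`. -/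
abbrev Cotangent (n : ℕ) (M : Type*) [TopologicalSpace M]
    [ChartedSpace (EuclideanSpace ℝ (Fin n)) M] :=
  Bundle.TotalSpace (EuclideanSpace ℝ (Fin n) →L[ℝ] ℝ)
    (fun x : M => TangentSpace (𝓡 n) x →L[ℝ] ℝ)

variable {n : ℕ} {M : Type*} [TopologicalSpace M] [ChartedSpace (EuclideanSpace ℝ (Fin n)) M]

/-- The coordinate vector `∂/∂x^i` of the chart `e` at the point with coordinates `y`. -/
def coordVec (e : OpenPartialHomeomorph M (EuclideanSpace ℝ (Fin n)))
    (y : EuclideanSpace ℝ (Fin n)) (i : Fin n) : TangentSpace (𝓡 n) (e.symm y) :=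
  mfderiv (𝓡 n) (𝓡 n) e.symm y (EuclideanSpace.single i (1 : ℝ))

/-- The coordinates `(q, p)` of a covector in the chart of `T*M` induced by the chart `e` of `M`:
`q^i` are the coordinates of the base point `x` and `p_i` is the value on `∂/∂x^i`. (Here
`e.symm (e x) = x` for `x` in the source of `e`, so `∂/∂x^i` is a tangent vector at `x`.) -/
def inducedCoord (e : OpenPartialHomeomorph M (EuclideanSpace ℝ (Fin n))) (P : Cotangent n M) :
    Fin n ⊕ Fin n → ℝ :=
  Sum.elim (fun i => e P.1 i) (fun i => P.2 (coordVec e (e P.1) i))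

variable [IsManifold (𝓡 n) ∞ M]

/-- The components `g_{ij}` of the metric `g` in the chart `e`, as functions of the coordinates. -/
def chartMetric (g : SmoothMetric n M) (e : OpenPartialHomeomorph M (EuclideanSpace ℝ (Fin n)))
    (y : Fin n → ℝ) : Matrix (Fin n) (Fin n) ℝ :=
  Matrix.of fun i j => g.inner (e.symm (WithLp.toLp 2 y)) (coordVec e (WithLp.toLp 2 y) i)
    (coordVec e (WithLp.toLp 2 y) j)

/-- The square `‖p‖² = g⁻¹(p, p)` of the norm of a covector. -/
def coNormSq (g : SmoothMetric n M) (P : Cotangent n M) : ℝ :=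
  P.2 ((g.inner P.1).inverse P.2)

/-- `(M, g)` has constant sectional curvature `c`. The sectional curvature of a plane at `x` is
computed in the smooth charts around `x`; it does not depend on the chart. -/
def HasConstantSectionalCurvature (g : SmoothMetric n M) (c : ℝ) : Prop :=
  ∀ x : M, ∀ e ∈ IsManifold.maximalAtlas (𝓡 n) ∞ M, x ∈ e.source →
    ∀ u v : Fin n → ℝ, LinearIndependent ℝ ![u, v] →
      sectionalCurvature (chartMetric g e) (WithLp.ofLp (e x)) u v = c

/-- The structure `(G, J)` on the open subset `U` of `T*M`, defined by `g`, `A` and `v`, has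
constant holomorphic sectional curvature. The holomorphic sectional curvature of a tangent vector
`X ≠ 0` at `P` is computed in the charts of `T*M` induced by the smooth charts of `M` around the
base point of `P`; it does not depend on the chart. -/
def HasConstantHolomorphicSectionalCurvature (g : SmoothMetric n M) (A : ℝ) (v : ℝ → ℝ)
    (U : Set (Cotangent n M)) : Prop :=
  ∃ k : ℝ, ∀ P ∈ U, ∀ e ∈ IsManifold.maximalAtlas (𝓡 n) ∞ M, P.1 ∈ e.source →
    ∀ X : Fin n ⊕ Fin n → ℝ, X ≠ 0 →
      holomorphicSectionalCurvature (chartMetric g e) A v (inducedCoord e P) X = k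

/-- The tube `0 ≤ ‖p‖² < A² / c` around the zero section of `T*M`. -/
def tube (g : SmoothMetric n M) (A c : ℝ) : Set (Cotangent n M) :=
  {P | coNormSq g P < A ^ 2 / c}

end Global

end CotangentKahler

end

/-!
The holomorphic sectional curvature already fails to be constant at a single point of the zero
section. There the structure resembles that of a Hermitian symmetric space of rank two with the zero
section as a real form: in the orthonormal directions `e₁`, `e₂` of the base, the complex direction
`e₁` and the isotropic direction `e₁ + J e₂` have different curvatures. Explicitly, for
`X = ∂/∂q^1 + s ∂/∂p_2` and `σ = s² / A²` the holomorphic sectional curvature is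
`(c / A) (1 + 6 σ + σ²) / (1 + σ)²`
(`IsNormalAt.holomorphicSectionalCurvature_zeroPoint`), so it is `c / A` for `s = 0` and `2 c / A` for
`s = A`, and these differ as `c ≠ 0`.

For the computation one takes a chart of the base, centred at the given point, in which the metric
agrees with the Euclidean one to first order (`exists_isNormalAt`): an affine change of coordinates
makes the components Euclidean at the point, and a quadratic one with the Christoffel symbols as
coefficients removes the first derivatives; the inverse function theorem makes these charts of the
maximal atlas (`exists_chart_pullback`). In the induced coordinates of the cotangent bundle the metric
`G` also has vanishing first derivatives at the point (`IsNormalAt.isFlatAt_cotangentMetric`), so its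
curvature tensor is the usual linear expression in its second derivatives
(`IsFlatAt.pairing_curvatureVec`). Those are found from the second-order jets of the factors of `G`
(`HasJet`), most of which drop out since `p = 0`. They involve the second derivatives of the metric of
the base, but these combine to the sectional curvature `c` of the plane of `e₁` and `e₂`.
-/

open scoped Manifold ContDiff

noncomputable section

namespace CotangentKahler

set_option linter.unusedSectionVars false

open Filter Topology

/-! ### Second-order jets of functions -/

section Jets

variable {κ : Type*} [Fintype κ] [DecidableEq κ]

theorem contDiffAt_partialDeriv {f : (κ → ℝ) → ℝ} {y : κ → ℝ} (hf : ContDiffAt ℝ ∞ f y) (i : κ) :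
    ContDiffAt ℝ ∞ (partialDeriv i f) y :=
  (hf.fderiv_right (m := ∞) (by simp)).clm_apply contDiffAt_const

theorem eventually_differentiableAt {f : (κ → ℝ) → ℝ} {y : κ → ℝ} (hf : ContDiffAt ℝ ∞ f y) :
    ∀ᶠ z in 𝓝 y, DifferentiableAt ℝ f z := by
  have h1 : ContDiffAt ℝ 1 f y := hf.of_le (by exact_mod_cast le_top)
  filter_upwards [h1.eventually (by simp)] with z hz
  exact hz.differentiableAt (by simp)

theorem partialDeriv_congr {f f' : (κ → ℝ) → ℝ} {y : κ → ℝ} (h : f =ᶠ[𝓝 y] f') (i : κ) :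
    partialDeriv i f =ᶠ[𝓝 y] partialDeriv i f' := by
  filter_upwards [h.eventuallyEq_nhds] with z hz
  simp only [partialDeriv, hz.fderiv_eq]

theorem partialDeriv_mul {f f' : (κ → ℝ) → ℝ} {y : κ → ℝ} (hf : DifferentiableAt ℝ f y)
    (hf' : DifferentiableAt ℝ f' y) (i : κ) :
    partialDeriv i (fun z => f z * f' z) y
      = f y * partialDeriv i f' y + partialDeriv i f y * f' y := by
  simp only [partialDeriv, fderiv_fun_mul hf hf']
  simp [mul_comm]

theorem partialDeriv_add {f f' : (κ → ℝ) → ℝ} {y : κ → ℝ} (hf : DifferentiableAt ℝ f y)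
    (hf' : DifferentiableAt ℝ f' y) (i : κ) :
    partialDeriv i (fun z => f z + f' z) y = partialDeriv i f y + partialDeriv i f' y := by
  simp only [partialDeriv, fderiv_fun_add hf hf']
  simp

theorem partialDeriv_sub {f f' : (κ → ℝ) → ℝ} {y : κ → ℝ} (hf : DifferentiableAt ℝ f y)
    (hf' : DifferentiableAt ℝ f' y) (i : κ) :
    partialDeriv i (fun z => f z - f' z) y = partialDeriv i f y - partialDeriv i f' y := by
  simp only [partialDeriv, fderiv_fun_sub hf hf']
  simp

theorem partialDeriv_sum {α : Type*} (s : Finset α) {f : α → (κ → ℝ) → ℝ} {y : κ → ℝ}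
    (hf : ∀ a ∈ s, DifferentiableAt ℝ (f a) y) (i : κ) :
    partialDeriv i (fun z => ∑ a ∈ s, f a z) y = ∑ a ∈ s, partialDeriv i (f a) y := by
  simp only [partialDeriv, fderiv_fun_sum hf]
  simp

theorem partialDeriv_const (a : ℝ) (i : κ) (y : κ → ℝ) :
    partialDeriv i (fun _ : κ → ℝ => a) y = 0 := by
  simp [partialDeriv]

theorem partialDeriv_const_mul {f : (κ → ℝ) → ℝ} {y : κ → ℝ} (hf : DifferentiableAt ℝ f y)
    (a : ℝ) (i : κ) :
    partialDeriv i (fun z => a * f z) y = a * partialDeriv i f y := by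
  rw [partialDeriv_mul (differentiableAt_const a) hf, partialDeriv_const]; simp

theorem partialDeriv_mul_of_eq_zero {f f' : (κ → ℝ) → ℝ} {y : κ → ℝ} (hf : DifferentiableAt ℝ f y)
    (hf' : DifferentiableAt ℝ f' y) (h0 : f' y = 0) (i : κ) :
    partialDeriv i (fun z => f z * f' z) y = f y * partialDeriv i f' y := by
  rw [partialDeriv_mul hf hf', h0]; simp

theorem partialDeriv_comm {f : (κ → ℝ) → ℝ} {y : κ → ℝ} (hf : ContDiffAt ℝ ∞ f y) (i j : κ) :
    partialDeriv i (partialDeriv j f) y = partialDeriv j (partialDeriv i f) y := by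
  have h2 : ContDiffAt ℝ ∞ (fderiv ℝ f) y := hf.fderiv_right (m := ∞) (by simp)
  have hd : DifferentiableAt ℝ (fderiv ℝ f) y := h2.differentiableAt (by simp)
  have key : ∀ a b : κ, partialDeriv a (partialDeriv b f) y
      = fderiv ℝ (fderiv ℝ f) y (Pi.single a 1) (Pi.single b 1) := by
    intro a b
    change fderiv ℝ (fun z => fderiv ℝ f z (Pi.single b 1)) y (Pi.single a 1) = _
    rw [fderiv_clm_apply hd (differentiableAt_const _)]
    simp
  rw [key, key]
  exact (hf.isSymmSndFDerivAt (by simp only [minSmoothness_of_isRCLikeNormedField]; exact WithTop.coe_le_coe.2 (le_top : (2 : ℕ∞) ≤ ⊤))) _ _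

/-- `f` is smooth at `y`, with value `a`, first partial derivatives `L` and second partial
derivatives `B` there. -/
structure HasJet (f : (κ → ℝ) → ℝ) (y : κ → ℝ) (a : ℝ) (L : κ → ℝ) (B : κ → κ → ℝ) : Prop where
  smooth : ContDiffAt ℝ ∞ f y
  value : f y = a
  first : ∀ i, partialDeriv i f y = L i
  second : ∀ i j, partialDeriv i (partialDeriv j f) y = B i j

namespace HasJet

variable {f f' : (κ → ℝ) → ℝ} {y : κ → ℝ} {a a' : ℝ} {L L' : κ → ℝ} {B B' : κ → κ → ℝ}

theorem self (hf : ContDiffAt ℝ ∞ f y) :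
    HasJet f y (f y) (fun i => partialDeriv i f y) (fun i j => partialDeriv i (partialDeriv j f) y) :=
  ⟨hf, rfl, fun _ => rfl, fun _ _ => rfl⟩

theorem differentiableAt (h : HasJet f y a L B) : DifferentiableAt ℝ f y :=
  h.smooth.differentiableAt (by simp)

theorem congr_fun (h : HasJet f y a L B) (hff : f' =ᶠ[𝓝 y] f) : HasJet f' y a L B where
  smooth := h.smooth.congr_of_eventuallyEq hff
  value := hff.eq_of_nhds.trans h.value
  first i := (partialDeriv_congr hff i).eq_of_nhds.trans (h.first i)
  second i j := (partialDeriv_congr (partialDeriv_congr hff j) i).eq_of_nhds.trans (h.second i j)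

theorem congr_jet (h : HasJet f y a L B) (ha : a = a') (hL : ∀ i, L i = L' i)
    (hB : ∀ i j, B i j = B' i j) : HasJet f y a' L' B' :=
  ⟨h.smooth, h.value.trans ha, fun i => (h.first i).trans (hL i),
    fun i j => (h.second i j).trans (hB i j)⟩

theorem const (a : ℝ) (y : κ → ℝ) : HasJet (fun _ => a) y a (fun _ => 0) (fun _ _ => 0) where
  smooth := contDiffAt_const
  value := rfl
  first i := partialDeriv_const a i y
  second i j := by
    have : partialDeriv j (fun _ : κ → ℝ => a) = fun _ => 0 := by
      funext z; exact partialDeriv_const a j z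
    rw [this, partialDeriv_const]

theorem mul (h : HasJet f y a L B) (h' : HasJet f' y a' L' B') :
    HasJet (fun z => f z * f' z) y (a * a') (fun i => a * L' i + L i * a')
      (fun i j => a * B' i j + L i * L' j + L j * L' i + B i j * a') where
  smooth := h.smooth.mul h'.smooth
  value := by rw [h.value, h'.value]
  first i := by
    rw [partialDeriv_mul h.differentiableAt h'.differentiableAt, h.value, h'.value, h.first,
      h'.first]
  second i j := by
    have e : partialDeriv j (fun z => f z * f' z) =ᶠ[𝓝 y]
        fun z => f z * partialDeriv j f' z + partialDeriv j f z * f' z := by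
      filter_upwards [eventually_differentiableAt h.smooth, eventually_differentiableAt h'.smooth] with z hz hz'
      exact partialDeriv_mul hz hz' j
    have d : DifferentiableAt ℝ (partialDeriv j f) y :=
      (contDiffAt_partialDeriv h.smooth j).differentiableAt (by simp)
    have d' : DifferentiableAt ℝ (partialDeriv j f') y :=
      (contDiffAt_partialDeriv h'.smooth j).differentiableAt (by simp)
    rw [(partialDeriv_congr e i).eq_of_nhds,
      partialDeriv_add (h.differentiableAt.fun_mul d') (d.fun_mul h'.differentiableAt),
      partialDeriv_mul h.differentiableAt d', partialDeriv_mul d h'.differentiableAt,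
      h.value, h'.value, h.first, h'.first, h.second, h'.second, h.first, h'.first]
    ring

theorem add (h : HasJet f y a L B) (h' : HasJet f' y a' L' B') :
    HasJet (fun z => f z + f' z) y (a + a') (fun i => L i + L' i)
      (fun i j => B i j + B' i j) where
  smooth := h.smooth.add h'.smooth
  value := by rw [h.value, h'.value]
  first i := by
    rw [partialDeriv_add h.differentiableAt h'.differentiableAt, h.first, h'.first]
  second i j := by
    have e : partialDeriv j (fun z => f z + f' z) =ᶠ[𝓝 y]
        fun z => partialDeriv j f z + partialDeriv j f' z := by
      filter_upwards [eventually_differentiableAt h.smooth, eventually_differentiableAt h'.smooth] with z hz hz'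
      exact partialDeriv_add hz hz' j
    have d : DifferentiableAt ℝ (partialDeriv j f) y :=
      (contDiffAt_partialDeriv h.smooth j).differentiableAt (by simp)
    have d' : DifferentiableAt ℝ (partialDeriv j f') y :=
      (contDiffAt_partialDeriv h'.smooth j).differentiableAt (by simp)
    rw [(partialDeriv_congr e i).eq_of_nhds, partialDeriv_add d d', h.second, h'.second]

theorem const_mul (h : HasJet f y a L B) (r : ℝ) :
    HasJet (fun z => r * f z) y (r * a) (fun i => r * L i) (fun i j => r * B i j) :=
  ((HasJet.const r y).mul h).congr_jet rfl (by simp) (by simp)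

theorem sum {α : Type*} (s : Finset α) {f : α → (κ → ℝ) → ℝ} {a : α → ℝ} {L : α → κ → ℝ}
    {B : α → κ → κ → ℝ} (h : ∀ r ∈ s, HasJet (f r) y (a r) (L r) (B r)) :
    HasJet (fun z => ∑ r ∈ s, f r z) y (∑ r ∈ s, a r) (fun i => ∑ r ∈ s, L r i)
      (fun i j => ∑ r ∈ s, B r i j) := by
  classical
  induction s using Finset.induction_on with
  | empty => simpa using HasJet.const 0 y
  | insert r s hr ih =>
    have := (h r (Finset.mem_insert_self r s)).add
      (ih fun t ht => h t (Finset.mem_insert_of_mem ht))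
    simpa only [Finset.sum_insert hr] using this

end HasJet

end Jets

/-! ### Curvature at a point where the metric has vanishing first derivatives -/

section Flat

variable {κ : Type*} [Fintype κ] [DecidableEq κ]

theorem contDiffAt_det {E : Type*} [NormedAddCommGroup E] [NormedSpace ℝ E]
    {h : E → Matrix κ κ ℝ} {y : E}
    (hs : ∀ i j, ContDiffAt ℝ ∞ (fun z => h z i j) y) :
    ContDiffAt ℝ ∞ (fun z => (h z).det) y := by
  simp only [Matrix.det_apply']
  refine ContDiffAt.sum fun σ _ => contDiffAt_const.mul ?_
  exact contDiffAt_prod fun i _ => hs _ _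

theorem contDiffAt_inv_apply {E : Type*} [NormedAddCommGroup E] [NormedSpace ℝ E]
    {h : E → Matrix κ κ ℝ} {y : E}
    (hs : ∀ i j, ContDiffAt ℝ ∞ (fun z => h z i j) y) (hu : IsUnit (h y).det) (i j : κ) :
    ContDiffAt ℝ ∞ (fun z => (h z)⁻¹ i j) y := by
  simp only [Matrix.inv_def, Ring.inverse_eq_inv, Matrix.smul_apply, smul_eq_mul,
    Matrix.adjugate_apply]
  refine ((contDiffAt_det hs).inv hu.ne_zero).mul (contDiffAt_det fun a b => ?_)
  by_cases hab : a = j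
  · subst hab; simpa using contDiffAt_const
  · simpa [Matrix.updateRow_ne hab] using hs a b

theorem contDiffAt_christoffel {h : (κ → ℝ) → Matrix κ κ ℝ} {y : κ → ℝ}
    (hs : ∀ i j, ContDiffAt ℝ ∞ (fun z => h z i j) y) (hu : IsUnit (h y).det) (k i j : κ) :
    ContDiffAt ℝ ∞ (fun z => christoffel h z k i j) y := by
  unfold christoffel
  refine contDiffAt_const.mul (ContDiffAt.sum fun l _ => ?_)
  exact (contDiffAt_inv_apply hs hu k l).mul
    (((contDiffAt_partialDeriv (hs j l) i).add (contDiffAt_partialDeriv (hs i l) j)).sub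
      (contDiffAt_partialDeriv (hs i j) l))

/-- The second partial derivative `∂_i ∂_j h_{kl}` at `y`. -/
def hess (h : (κ → ℝ) → Matrix κ κ ℝ) (y : κ → ℝ) (i j k l : κ) : ℝ :=
  partialDeriv i (partialDeriv j fun z => h z k l) y

/-- The Hessian of the metric, contracted with four vectors: `(∂_a ∂_b h)(c, d)`. -/
def hessForm (h : (κ → ℝ) → Matrix κ κ ℝ) (y a b c d : κ → ℝ) : ℝ :=
  ∑ i, ∑ j, ∑ k, ∑ l, hess h y i j k l * a i * b j * c k * d l

theorem sum_quadruple_perm (σ : κ × κ × κ × κ ≃ κ × κ × κ × κ)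
    (F : κ × κ × κ × κ → ℝ) :
    ∑ a, ∑ b, ∑ c, ∑ d, F (a, b, c, d) = ∑ a, ∑ b, ∑ c, ∑ d, F (σ (a, b, c, d)) := by
  have key : ∀ F : κ × κ × κ × κ → ℝ, ∑ a, ∑ b, ∑ c, ∑ d, F (a, b, c, d) = ∑ x, F x := by
    intro F; simp only [Fintype.sum_prod_type]
  rw [key, key fun x => F (σ x)]
  exact (Equiv.sum_comp σ F).symm

/-- `h` is smooth at `y` and invertible there, it is symmetric, and all of its first partial
derivatives vanish at `y`. Thus the coordinates are geodesic at `y`. Symmetry is required at every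
point, which is what the component matrices of a metric satisfy. -/
structure IsFlatAt (h : (κ → ℝ) → Matrix κ κ ℝ) (y : κ → ℝ) : Prop where
  smooth : ∀ i j, ContDiffAt ℝ ∞ (fun z => h z i j) y
  isUnit_det : IsUnit (h y).det
  symm : ∀ z i j, h z i j = h z j i
  first : ∀ k i j, partialDeriv k (fun z => h z i j) y = 0

namespace IsFlatAt

variable {h : (κ → ℝ) → Matrix κ κ ℝ} {y : κ → ℝ}

theorem christoffel_eq_zero (hh : IsFlatAt h y) (k i j : κ) : christoffel h y k i j = 0 := by
  simp [christoffel, hh.first]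

/-- Where the first derivatives of the metric vanish, only the second derivatives contribute to the
derivatives of the Christoffel symbols. -/
theorem partialDeriv_christoffel (hh : IsFlatAt h y) (m k i j : κ) :
    partialDeriv m (fun z => christoffel h z k i j) y
      = (1 / 2 : ℝ) * ∑ l, (h y)⁻¹ k l *
        (hess h y m i j l + hess h y m j i l - hess h y m l i j) := by
  have d : ∀ a b c : κ, DifferentiableAt ℝ (fun z => partialDeriv a (fun w => h w b c) z) y :=
    fun a b c => (contDiffAt_partialDeriv (hh.smooth b c) a).differentiableAt (by simp)
  have di : ∀ a b : κ, DifferentiableAt ℝ (fun z => (h z)⁻¹ a b) y :=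
    fun a b => (contDiffAt_inv_apply hh.smooth hh.isUnit_det a b).differentiableAt (by simp)
  unfold christoffel
  rw [partialDeriv_const_mul]
  · rw [partialDeriv_sum]
    · congr 1
      refine Finset.sum_congr rfl fun l _ => ?_
      rw [partialDeriv_mul_of_eq_zero (di _ _) (((d _ _ _).fun_add (d _ _ _)).fun_sub (d _ _ _)),
        partialDeriv_sub ((d _ _ _).fun_add (d _ _ _)) (d _ _ _),
        partialDeriv_add (d _ _ _) (d _ _ _)]
      · rfl
      · simp [hh.first]
    · exact fun l _ => (di _ _).fun_mul (((d _ _ _).fun_add (d _ _ _)).fun_sub (d _ _ _))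
  · exact DifferentiableAt.fun_sum
      fun l _ => (di _ _).fun_mul (((d _ _ _).fun_add (d _ _ _)).fun_sub (d _ _ _))

theorem hess_comm (hh : IsFlatAt h y) (i j k l : κ) : hess h y i j k l = hess h y j i k l :=
  partialDeriv_comm (hh.smooth k l) i j

theorem hess_symm (hh : IsFlatAt h y) (i j k l : κ) : hess h y i j k l = hess h y i j l k := by
  have : (fun z => h z k l) = fun z => h z l k := by funext z; exact hh.symm z k l
  simp only [hess, this]

theorem curvature_eq (hh : IsFlatAt h y) (l k i j : κ) :
    curvature h y l k i j = (1 / 2 : ℝ) * ∑ m, (h y)⁻¹ l m *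
      (hess h y i k j m - hess h y i m j k - hess h y j k i m + hess h y j m i k) := by
  simp only [curvature, hh.christoffel_eq_zero, hh.partialDeriv_christoffel]
  rw [← mul_sub, ← Finset.sum_sub_distrib]
  simp only [mul_zero, sub_zero, Finset.sum_const_zero, add_zero]
  congr 1
  refine Finset.sum_congr rfl fun m _ => ?_
  rw [hh.hess_comm j i k m]
  ring

/-- Where the first derivatives of the metric vanish, the numerator of the sectional curvature is
`(∂_u ∂_v h)(v, u) - ½ (∂_u ∂_u h)(v, v) - ½ (∂_v ∂_v h)(u, u)`. -/
theorem pairing_curvatureVec (hh : IsFlatAt h y) (u v : κ → ℝ) :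
    pairing h y (curvatureVec h y u v v) u
      = hessForm h y u v v u - (1 / 2 : ℝ) * hessForm h y u u v v
        - (1 / 2 : ℝ) * hessForm h y v v u u := by
  set w : κ → ℝ := fun m => ∑ i, ∑ j, ∑ k, (1 / 2 : ℝ) *
    (hess h y i k j m - hess h y i m j k - hess h y j k i m + hess h y j m i k)
      * u i * v j * v k with hw
  have hK : curvatureVec h y u v v = (h y)⁻¹.mulVec w := by
    funext l
    simp only [curvatureVec, hh.curvature_eq, Matrix.mulVec, dotProduct, hw, Finset.mul_sum,
      Finset.sum_mul]
    conv_rhs => rw [Finset.sum_comm]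
    refine Finset.sum_congr rfl fun i _ => ?_
    conv_rhs => rw [Finset.sum_comm]
    refine Finset.sum_congr rfl fun j _ => ?_
    conv_rhs => rw [Finset.sum_comm]
    refine Finset.sum_congr rfl fun k _ => Finset.sum_congr rfl fun m _ => ?_
    ring
  have hP : pairing h y (curvatureVec h y u v v) u = ∑ m, w m * u m := by
    have h1 : (h y).mulVec (curvatureVec h y u v v) = w := by
      rw [hK, Matrix.mulVec_mulVec, Matrix.mul_nonsing_inv _ hh.isUnit_det, Matrix.one_mulVec]
    have h2 : ∀ m, w m = ∑ l, h y l m * curvatureVec h y u v v l := by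
      intro m
      conv_lhs => rw [← h1]
      simp only [Matrix.mulVec, dotProduct]
      exact Finset.sum_congr rfl fun l _ => by rw [hh.symm]
    simp only [h2, Finset.sum_mul, pairing]
    rw [Finset.sum_comm]
  -- the four terms of `curvature_eq`, with `m` the outermost index of summation
  have e1 : hessForm h y u v v u
      = ∑ m, ∑ i, ∑ j, ∑ k, hess h y i k j m * u i * v j * v k * u m := by
    refine (sum_quadruple_perm ⟨fun (m, i, j, k) => (i, k, j, m), fun (a, b, c, d) => (d, a, c, b),
      fun _ => rfl, fun _ => rfl⟩ (fun (a, b, c, d) => hess h y a b c d * u a * v b * v c * u d)).trans ?_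
    refine Finset.sum_congr rfl fun m _ => Finset.sum_congr rfl fun i _ =>
      Finset.sum_congr rfl fun j _ => Finset.sum_congr rfl fun k _ => ?_
    simp only [Equiv.coe_fn_mk]
    ring
  have e4 : hessForm h y u v v u
      = ∑ m, ∑ i, ∑ j, ∑ k, hess h y j m i k * u i * v j * v k * u m := by
    refine (sum_quadruple_perm ⟨fun (m, i, j, k) => (m, j, k, i), fun (a, b, c, d) => (a, d, b, c),
      fun _ => rfl, fun _ => rfl⟩ (fun (a, b, c, d) => hess h y a b c d * u a * v b * v c * u d)).trans ?_
    refine Finset.sum_congr rfl fun m _ => Finset.sum_congr rfl fun i _ =>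
      Finset.sum_congr rfl fun j _ => Finset.sum_congr rfl fun k _ => ?_
    simp only [Equiv.coe_fn_mk]
    rw [hh.hess_comm j m i k, hh.hess_symm m j i k]
    ring
  have e2 : hessForm h y u u v v
      = ∑ m, ∑ i, ∑ j, ∑ k, hess h y i m j k * u i * v j * v k * u m := by
    refine (sum_quadruple_perm ⟨fun (m, i, j, k) => (i, m, j, k), fun (a, b, c, d) => (b, a, c, d),
      fun _ => rfl, fun _ => rfl⟩ (fun (a, b, c, d) => hess h y a b c d * u a * u b * v c * v d)).trans ?_
    refine Finset.sum_congr rfl fun m _ => Finset.sum_congr rfl fun i _ =>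
      Finset.sum_congr rfl fun j _ => Finset.sum_congr rfl fun k _ => ?_
    simp only [Equiv.coe_fn_mk]
    ring
  have e3 : hessForm h y v v u u
      = ∑ m, ∑ i, ∑ j, ∑ k, hess h y j k i m * u i * v j * v k * u m := by
    refine (sum_quadruple_perm ⟨fun (m, i, j, k) => (j, k, i, m), fun (a, b, c, d) => (d, c, a, b),
      fun _ => rfl, fun _ => rfl⟩ (fun (a, b, c, d) => hess h y a b c d * v a * v b * u c * u d)).trans ?_
    refine Finset.sum_congr rfl fun m _ => Finset.sum_congr rfl fun i _ =>
      Finset.sum_congr rfl fun j _ => Finset.sum_congr rfl fun k _ => ?_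
    simp only [Equiv.coe_fn_mk]
    ring
  rw [hP, e2, e3]
  have : hessForm h y u v v u = (1 / 2 : ℝ) * hessForm h y u v v u
      + (1 / 2 : ℝ) * hessForm h y u v v u := by ring
  rw [this]
  nth_rewrite 1 [e1]
  rw [e4]
  simp only [hw, Finset.sum_mul, Finset.mul_sum, ← Finset.sum_add_distrib,
    ← Finset.sum_sub_distrib]
  refine Finset.sum_congr rfl fun m _ => Finset.sum_congr rfl fun i _ =>
    Finset.sum_congr rfl fun j _ => Finset.sum_congr rfl fun k _ => ?_
  ring

end IsFlatAt
end Flat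

/-! ### Jets along the zero section -/

section ZeroSection

variable {ι : Type*} [Fintype ι] [DecidableEq ι]

/-- The point with coordinates `y` of the zero section of the cotangent bundle. -/
def zeroPoint (y : ι → ℝ) : ι ⊕ ι → ℝ := Sum.elim y 0

@[simp] theorem posn_zeroPoint (y : ι → ℝ) : posn (zeroPoint y) = y := rfl

@[simp] theorem mom_zeroPoint (y : ι → ℝ) : mom (zeroPoint y) = 0 := rfl

/-- `posn` as a continuous linear map. -/
def posnCLM : (ι ⊕ ι → ℝ) →L[ℝ] (ι → ℝ) :=
  ContinuousLinearMap.pi fun i => ContinuousLinearMap.proj (Sum.inl i)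

theorem posnCLM_apply (z : ι ⊕ ι → ℝ) : posnCLM z = posn z := rfl

theorem posnCLM_single_inl (i : ι) : posnCLM (Pi.single (Sum.inl i) 1) = Pi.single i (1 : ℝ) := by
  funext j
  simp only [posnCLM_apply, posn, Pi.single_apply, Sum.inl.injEq]

theorem posnCLM_single_inr (i : ι) :
    posnCLM (Pi.single (Sum.inr i) 1) = (0 : ι → ℝ) := by
  funext j
  simp [posnCLM_apply, posn]

theorem partialDeriv_inl_comp_posn {f : (ι → ℝ) → ℝ} {z : ι ⊕ ι → ℝ}
    (hf : DifferentiableAt ℝ f (posn z)) (i : ι) :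
    partialDeriv (Sum.inl i) (fun w => f (posn w)) z = partialDeriv i f (posn z) := by
  have : HasFDerivAt (fun w => f (posn w)) ((fderiv ℝ f (posn z)).comp posnCLM) z :=
    hf.hasFDerivAt.comp z posnCLM.hasFDerivAt
  rw [partialDeriv, this.fderiv, ContinuousLinearMap.comp_apply, posnCLM_single_inl, partialDeriv]

theorem partialDeriv_inr_comp_posn {f : (ι → ℝ) → ℝ} {z : ι ⊕ ι → ℝ}
    (hf : DifferentiableAt ℝ f (posn z)) (i : ι) :
    partialDeriv (Sum.inr i) (fun w => f (posn w)) z = 0 := by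
  have : HasFDerivAt (fun w => f (posn w)) ((fderiv ℝ f (posn z)).comp posnCLM) z :=
    hf.hasFDerivAt.comp z posnCLM.hasFDerivAt
  rw [partialDeriv, this.fderiv, ContinuousLinearMap.comp_apply, posnCLM_single_inr, map_zero]

theorem HasJet.comp_posn {f : (ι → ℝ) → ℝ} {y : ι → ℝ} {a : ℝ} {L : ι → ℝ} {B : ι → ι → ℝ}
    (h : HasJet f y a L B) :
    HasJet (fun z => f (posn z)) (zeroPoint y) a (Sum.elim L 0)
      (fun α β => Sum.elim (fun i => Sum.elim (B i) 0 β) 0 α) where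
  smooth := ContDiffAt.comp (zeroPoint y) (g := f) (f := fun z => posn z) h.smooth
    (posnCLM (ι := ι)).contDiff.contDiffAt
  value := h.value
  first α := by
    rcases α with i | i
    · exact (partialDeriv_inl_comp_posn h.differentiableAt i).trans (h.first i)
    · exact partialDeriv_inr_comp_posn h.differentiableAt i
  second α β := by
    have ev : ∀ᶠ z in 𝓝 (zeroPoint y), DifferentiableAt ℝ f (posn z) :=
      (posnCLM.continuous.continuousAt (x := zeroPoint y)).eventually
        (eventually_differentiableAt h.smooth)
    rcases β with j | j
    · have e : partialDeriv (Sum.inl j) (fun z => f (posn z)) =ᶠ[𝓝 (zeroPoint y)]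
          fun z => partialDeriv j f (posn z) := by
        filter_upwards [ev] with z hz using partialDeriv_inl_comp_posn hz j
      have d : DifferentiableAt ℝ (partialDeriv j f) (posn (zeroPoint y)) :=
        (contDiffAt_partialDeriv h.smooth j).differentiableAt (by simp)
      rw [(partialDeriv_congr e α).eq_of_nhds]
      rcases α with i | i
      · exact (partialDeriv_inl_comp_posn d i).trans (h.second i j)
      · exact partialDeriv_inr_comp_posn d i
    · have e : partialDeriv (Sum.inr j) (fun z => f (posn z)) =ᶠ[𝓝 (zeroPoint y)] fun _ => 0 := by
        filter_upwards [ev] with z hz using partialDeriv_inr_comp_posn hz j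
      rw [(partialDeriv_congr e α).eq_of_nhds, partialDeriv_const]
      rcases α with i | i <;> rfl

theorem hasJet_mom (y : ι → ℝ) (k : ι) :
    HasJet (fun z => mom z k) (zeroPoint y) 0 (Pi.single (Sum.inr k) 1) (fun _ _ => 0) := by
  have key : ∀ α z, partialDeriv α (fun z : ι ⊕ ι → ℝ => mom z k) z
      = (Pi.single (Sum.inr k) 1 : ι ⊕ ι → ℝ) α := by
    intro α z
    have : HasFDerivAt (fun z : ι ⊕ ι → ℝ => mom z k)
      (ContinuousLinearMap.proj (R := ℝ) (φ := fun _ : ι ⊕ ι => ℝ) (Sum.inr k)) z :=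
      (ContinuousLinearMap.proj (R := ℝ) (φ := fun _ : ι ⊕ ι => ℝ) (Sum.inr k)).hasFDerivAt
    rw [partialDeriv, this.fderiv, ContinuousLinearMap.proj_apply, Pi.single_comm]
  refine ⟨?_, rfl, fun α => key α _, fun α β => ?_⟩
  · exact (ContinuousLinearMap.proj (R := ℝ) (φ := fun _ : ι ⊕ ι => ℝ)
      (Sum.inr k)).contDiff.contDiffAt
  · have : partialDeriv β (fun z : ι ⊕ ι → ℝ => mom z k)
        = fun _ => (Pi.single (Sum.inr k) 1 : ι ⊕ ι → ℝ) β := by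
      funext z; exact key β z
    rw [this, partialDeriv_const]

/-- The second partial derivatives of `p_i p_j`. -/
def momHess (i j : ι) (α β : ι ⊕ ι) : ℝ :=
  (Pi.single (Sum.inr i) 1 : ι ⊕ ι → ℝ) α * (Pi.single (Sum.inr j) 1 : ι ⊕ ι → ℝ) β
    + (Pi.single (Sum.inr i) 1 : ι ⊕ ι → ℝ) β * (Pi.single (Sum.inr j) 1 : ι ⊕ ι → ℝ) α

/-- The second partial derivatives of `Γ⁰_{ij}` at a point of the zero section. -/
def gammaHess (h : (ι → ℝ) → Matrix ι ι ℝ) (y : ι → ℝ) (i j : ι)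
    (α β : ι ⊕ ι) : ℝ :=
  ∑ k, ((Pi.single (Sum.inr k) 1 : ι ⊕ ι → ℝ) α *
      Sum.elim (fun m => (1 / 2 : ℝ) *
        (hess h y m i j k + hess h y m j i k - hess h y m k i j)) 0 β
    + (Pi.single (Sum.inr k) 1 : ι ⊕ ι → ℝ) β *
      Sum.elim (fun m => (1 / 2 : ℝ) *
        (hess h y m i j k + hess h y m j i k - hess h y m k i j)) 0 α)

/-- `h` is a metric which agrees with the Euclidean metric to first order at `y`. -/
structure IsNormalAt (h : (ι → ℝ) → Matrix ι ι ℝ) (y : ι → ℝ) : Prop extends IsFlatAt h y where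
  eq_one : h y = 1

namespace IsNormalAt

variable {h : (ι → ℝ) → Matrix ι ι ℝ} {y : ι → ℝ}

theorem hasJet (hh : IsNormalAt h y) (i j : ι) :
    HasJet (fun z => h z i j) y ((1 : Matrix ι ι ℝ) i j) (fun _ => 0)
      (fun k l => hess h y k l i j) :=
  ⟨hh.smooth i j, by simp only [hh.eq_one], fun k => hh.first k i j, fun _ _ => rfl⟩

theorem hasJet_inv (hh : IsNormalAt h y) (i j : ι) :
    HasJet (fun z => (h z)⁻¹ i j) y ((1 : Matrix ι ι ℝ) i j) (fun _ => 0)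
      (fun k l => - hess h y k l i j) := by
  -- differentiate `∑ m, h_{im} (h⁻¹)_{mj} = δ_{ij}` twice
  have hi : ∀ m j, HasJet (fun z => (h z)⁻¹ m j) y ((h y)⁻¹ m j) _ _ := fun m j =>
    HasJet.self (contDiffAt_inv_apply hh.smooth hh.isUnit_det m j)
  have hsum := HasJet.sum Finset.univ fun m (_ : m ∈ Finset.univ) => (hh.hasJet i m).mul (hi m j)
  have hev : (fun z => ∑ m, h z i m * (h z)⁻¹ m j) =ᶠ[𝓝 y] fun _ => (1 : Matrix ι ι ℝ) i j := by
    have hne : ∀ᶠ z in 𝓝 y, (h z).det ≠ 0 :=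
      (contDiffAt_det hh.smooth).continuousAt.eventually_ne hh.isUnit_det.ne_zero
    filter_upwards [hne] with z hz
    rw [← Matrix.mul_apply, Matrix.mul_nonsing_inv _ (isUnit_iff_ne_zero.2 hz)]
  have hc := (HasJet.const ((1 : Matrix ι ι ℝ) i j) y).congr_fun hev
  have h1 : ∀ k, partialDeriv k (fun z => (h z)⁻¹ i j) y = 0 := by
    intro k
    have := (hsum.first k).symm.trans (hc.first k)
    simpa [Matrix.one_apply] using this
  refine ⟨contDiffAt_inv_apply hh.smooth hh.isUnit_det i j, by simp only [hh.eq_one, inv_one],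
    h1, fun k l => ?_⟩
  have := (hsum.second k l).symm.trans (hc.second k l)
  simp only [hh.eq_one, inv_one, Matrix.one_apply, zero_mul, add_zero, Finset.sum_add_distrib, ite_mul,
    one_mul, mul_ite, mul_one, mul_zero, Finset.sum_ite_eq, Finset.sum_ite_eq', Finset.mem_univ,
    if_true] at this
  linarith

/-- The second derivatives of the Christoffel symbols are left unspecified: in `Γ⁰` they are
multiplied by the momenta, which vanish on the zero section. -/
theorem hasJet_christoffel_comp (hh : IsNormalAt h y) (k i j : ι) :
    HasJet (fun z => christoffel h (posn z) k i j) (zeroPoint y) 0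
      (Sum.elim (fun m => (1 / 2 : ℝ) * (hess h y m i j k + hess h y m j i k - hess h y m k i j)) 0)
      (fun α β => partialDeriv α (partialDeriv β fun z => christoffel h (posn z) k i j)
        (zeroPoint y)) := by
  have := (HasJet.self (contDiffAt_christoffel hh.smooth hh.isUnit_det k i j)).comp_posn
  refine ⟨this.smooth, hh.christoffel_eq_zero k i j, fun α => ?_, fun _ _ => rfl⟩
  rw [this.first]
  rcases α with m | m
  · simp [hh.partialDeriv_christoffel, hh.eq_one, Matrix.one_apply]
  · rfl

theorem hasJet_christoffelZero (hh : IsNormalAt h y) (i j : ι) :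
    HasJet (fun z => christoffelZero h z i j) (zeroPoint y) 0 (fun _ => 0)
      (gammaHess h y i j) := by
  refine (HasJet.sum Finset.univ fun k (_ : k ∈ Finset.univ) =>
    (hasJet_mom y k).mul (hh.hasJet_christoffel_comp k i j)).congr_jet ?_ ?_ ?_
  · simp
  · simp
  · intro α β
    simp [gammaHess]

theorem hasJet_raisedMom (hh : IsNormalAt h y) (i : ι) :
    HasJet (fun z => raisedMom h z i) (zeroPoint y) 0 (Pi.single (Sum.inr i) 1)
      (fun α β => partialDeriv α (partialDeriv β fun z => raisedMom h z i) (zeroPoint y)) := by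
  have := HasJet.sum Finset.univ fun k (_ : k ∈ Finset.univ) =>
    (hasJet_mom y k).mul (hh.hasJet_inv k i).comp_posn
  refine ⟨this.smooth, this.value.trans (by simp), fun α => (this.first α).trans ?_, fun _ _ => rfl⟩
  simp [Matrix.one_apply]

theorem contDiffAt_energyDensity (hh : IsNormalAt h y) :
    ContDiffAt ℝ ∞ (energyDensity h) (zeroPoint y) := by
  unfold energyDensity
  refine contDiffAt_const.mul (ContDiffAt.sum fun i _ => ContDiffAt.sum fun k _ => ?_)
  exact ((hh.hasJet_inv i k).comp_posn.smooth.mul (hasJet_mom y i).smooth).mul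
    (hasJet_mom y k).smooth

theorem hasJet_lowerG (hh : IsNormalAt h y) (A b : ℝ) (i j : ι) :
    HasJet (fun z => lowerG h A (fun _ => b) z i j) (zeroPoint y) (A * (1 : Matrix ι ι ℝ) i j)
      (fun _ => 0)
      (fun α β => A * Sum.elim (fun k => Sum.elim (fun l => hess h y k l i j) 0 β) 0 α
        + b * momHess i j α β) := by
  have h1 := ((hh.hasJet i j).comp_posn.const_mul A).add
    ((((HasJet.const b (zeroPoint y)).mul (hasJet_mom y i)).mul (hasJet_mom y j)))
  refine h1.congr_jet (by simp) (fun α => ?_) (fun α β => ?_)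
  · rcases α with k | k <;> simp
  · simp [momHess]; ring

/-- Only the value `-b / A²` of the coefficient `w` at `t = 0` matters, since `g^{0k} g^{0l}` vanishes
to second order. -/
theorem hasJet_upperH (hh : IsNormalAt h y) {A : ℝ} (hA : A ≠ 0) (b : ℝ) (i j : ι) :
    HasJet (fun z => upperH h A (fun _ => b) z i j) (zeroPoint y)
      (1 / A * (1 : Matrix ι ι ℝ) i j) (fun _ => 0)
      (fun α β => - (1 / A) * Sum.elim (fun k => Sum.elim (fun l => hess h y k l i j) 0 β) 0 α
        - b / A ^ 2 * momHess i j α β) := by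
  have hw : ContDiffAt ℝ ∞ (fun z => auxW A (fun _ => b) (energyDensity h z)) (zeroPoint y) := by
    unfold auxW
    refine contDiffAt_const.div (contDiffAt_const.mul (contDiffAt_const.add
      ((contDiffAt_const.mul hh.contDiffAt_energyDensity).mul contDiffAt_const))) ?_
    simp [energyDensity, hA]
  have h1 := ((hh.hasJet_inv i j).comp_posn.const_mul (1 / A)).add
    (((HasJet.self hw).mul (hh.hasJet_raisedMom i)).mul (hh.hasJet_raisedMom j))
  refine h1.congr_jet (by simp) (fun α => ?_) (fun α β => ?_)
  · rcases α with k | k <;> simp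
  · have : auxW A (fun _ => b) (energyDensity h (zeroPoint y)) = - (b / A ^ 2) := by
      simp [auxW, energyDensity]
      field_simp
    simp only [this, momHess]
    rcases α with k | k <;> rcases β with l | l <;> simp [mul_add]; ring

end IsNormalAt

end ZeroSection

/-! ### Second derivatives of the metric of the cotangent bundle -/

section CotangentMetric

variable {ι : Type*} [Fintype ι] [DecidableEq ι]

theorem absDiff_single_inl (g : (ι → ℝ) → Matrix ι ι ℝ) (z : ι ⊕ ι → ℝ) (i j : ι) :
    absDiff g z i (Pi.single (Sum.inl j) 1) = -christoffelZero g z i j := by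
  simp [absDiff, Pi.single_apply]

theorem absDiff_single_inr (g : (ι → ℝ) → Matrix ι ι ℝ) (z : ι ⊕ ι → ℝ) (i j : ι) :
    absDiff g z i (Pi.single (Sum.inr j) 1) = (1 : Matrix ι ι ℝ) i j := by
  simp [absDiff, Pi.single_apply, Matrix.one_apply]

variable (g : (ι → ℝ) → Matrix ι ι ℝ) (A : ℝ) (v : ℝ → ℝ) (z : ι ⊕ ι → ℝ) (i j : ι)

theorem cotangentMetric_inl_inl :
    cotangentMetric g A v z (Sum.inl i) (Sum.inl j) = lowerG g A v z i j
      + ∑ a, ∑ b, upperH g A v z a b * christoffelZero g z a i * christoffelZero g z b j := by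
  simp [cotangentMetric, cotangentForm, absDiff_single_inl, Pi.single_apply]

theorem cotangentMetric_inl_inr :
    cotangentMetric g A v z (Sum.inl i) (Sum.inr j)
      = -∑ a, upperH g A v z a j * christoffelZero g z a i := by
  simp [cotangentMetric, cotangentForm, absDiff_single_inl, absDiff_single_inr, Pi.single_apply,
    Matrix.one_apply]

theorem cotangentMetric_inr_inl :
    cotangentMetric g A v z (Sum.inr i) (Sum.inl j)
      = -∑ b, upperH g A v z i b * christoffelZero g z b j := by
  simp [cotangentMetric, cotangentForm, absDiff_single_inl, absDiff_single_inr, Pi.single_apply,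
    Matrix.one_apply]

theorem cotangentMetric_inr_inr :
    cotangentMetric g A v z (Sum.inr i) (Sum.inr j) = upperH g A v z i j := by
  simp [cotangentMetric, cotangentForm, absDiff_single_inr, Pi.single_apply, Matrix.one_apply]

theorem lowerG_symm (hg : ∀ y i j, g y i j = g y j i) : lowerG g A v z i j = lowerG g A v z j i := by
  unfold lowerG; rw [hg]; ring

theorem upperH_symm (hg : ∀ y i j, g y i j = g y j i) : upperH g A v z i j = upperH g A v z j i := by
  have h1 : (g (posn z)).transpose = g (posn z) := by ext a b; exact hg _ _ _
  have h2 : (g (posn z))⁻¹ i j = (g (posn z))⁻¹ j i := by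
    conv_lhs => rw [← h1, ← Matrix.transpose_nonsing_inv, Matrix.transpose_apply]
  unfold upperH; rw [h2]; ring

theorem cotangentMetric_symm (hg : ∀ y i j, g y i j = g y j i) (α β : ι ⊕ ι) :
    cotangentMetric g A v z α β = cotangentMetric g A v z β α := by
  rcases α with i | i <;> rcases β with j | j
  · rw [cotangentMetric_inl_inl, cotangentMetric_inl_inl, lowerG_symm g A v z i j hg,
      Finset.sum_comm]
    congr 1
    refine Finset.sum_congr rfl fun a _ => Finset.sum_congr rfl fun b _ => ?_
    rw [upperH_symm g A v z b a hg]; ring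
  · rw [cotangentMetric_inl_inr, cotangentMetric_inr_inl]
    simp only [upperH_symm g A v z j _ hg]
  · rw [cotangentMetric_inl_inr, cotangentMetric_inr_inl]
    simp only [upperH_symm g A v z i _ hg]
  · rw [cotangentMetric_inr_inr, cotangentMetric_inr_inr, upperH_symm g A v z i j hg]

end CotangentMetric

namespace IsNormalAt

variable {ι : Type*} [Fintype ι] [DecidableEq ι] {h : (ι → ℝ) → Matrix ι ι ℝ} {y : ι → ℝ}

variable (hh : IsNormalAt h y) {A : ℝ} (hA : A ≠ 0) (b : ℝ)
include hh hA

theorem hasJet_cotangentMetric_inl_inl (i j : ι) :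
    HasJet (fun z => cotangentMetric h A (fun _ => b) z (Sum.inl i) (Sum.inl j)) (zeroPoint y)
      (A * (1 : Matrix ι ι ℝ) i j) (fun _ => 0)
      (fun α β => A * Sum.elim (fun k => Sum.elim (fun l => hess h y k l i j) 0 β) 0 α
        + b * momHess i j α β) := by
  simp only [cotangentMetric_inl_inl]
  refine ((hh.hasJet_lowerG A b i j).add (HasJet.sum Finset.univ fun a (_ : a ∈ Finset.univ) =>
    HasJet.sum Finset.univ fun c (_ : c ∈ Finset.univ) => (((hh.hasJet_upperH hA b a c).mul
      (hh.hasJet_christoffelZero a i)).mul (hh.hasJet_christoffelZero c j)))).congr_jet ?_ ?_ ?_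
  · simp
  · simp
  · simp

theorem hasJet_cotangentMetric_inl_inr (i j : ι) :
    HasJet (fun z => cotangentMetric h A (fun _ => b) z (Sum.inl i) (Sum.inr j)) (zeroPoint y)
      0 (fun _ => 0) (fun α β => -(1 / A * gammaHess h y j i α β)) := by
  have e : (fun z => cotangentMetric h A (fun _ => b) z (Sum.inl i) (Sum.inr j))
      = fun z => (-1 : ℝ) *
        ∑ a, upperH h A (fun _ => b) z a j * christoffelZero h z a i := by
    funext z; rw [cotangentMetric_inl_inr]; ring
  rw [e]
  refine ((HasJet.sum Finset.univ fun a (_ : a ∈ Finset.univ) => ((hh.hasJet_upperH hA b a j).mul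
      (hh.hasJet_christoffelZero a i))).const_mul (-1)).congr_jet ?_ ?_ ?_
  · simp
  · simp
  · intro α β
    simp only [zero_mul, mul_zero, add_zero, Matrix.one_apply, mul_ite, mul_one, ite_mul,
      Finset.sum_ite_eq', Finset.mem_univ, if_true]
    rw [gammaHess]; ring

theorem hasJet_cotangentMetric_inr_inr (i j : ι) :
    HasJet (fun z => cotangentMetric h A (fun _ => b) z (Sum.inr i) (Sum.inr j)) (zeroPoint y)
      (1 / A * (1 : Matrix ι ι ℝ) i j) (fun _ => 0)
      (fun α β => - (1 / A) * Sum.elim (fun k => Sum.elim (fun l => hess h y k l i j) 0 β) 0 α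
        - b / A ^ 2 * momHess i j α β) := by
  simp only [cotangentMetric_inr_inr]
  exact hh.hasJet_upperH hA b i j

theorem cotangentMetric_zeroPoint :
    cotangentMetric h A (fun _ => b) (zeroPoint y)
      = Matrix.diagonal (Sum.elim (fun _ => A) (fun _ => 1 / A)) := by
  ext α β
  rcases α with i | i <;> rcases β with j | j
  · rw [(hh.hasJet_cotangentMetric_inl_inl hA b i j).value]
    simp [Matrix.diagonal_apply, Matrix.one_apply]
  · rw [(hh.hasJet_cotangentMetric_inl_inr hA b i j).value]
    simp
  · rw [cotangentMetric_symm _ _ _ _ hh.symm,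
      (hh.hasJet_cotangentMetric_inl_inr hA b j i).value]
    simp
  · rw [(hh.hasJet_cotangentMetric_inr_inr hA b i j).value]
    simp [Matrix.diagonal_apply, Matrix.one_apply]

/-- Coordinates in which the metric of the base is Euclidean to first order induce coordinates in
which the metric of the cotangent bundle has vanishing first derivatives on the zero section. -/
theorem isFlatAt_cotangentMetric :
    IsFlatAt (cotangentMetric h A fun _ => b) (zeroPoint y) := by
  have hsymm : ∀ i j, (fun z => cotangentMetric h A (fun _ => b) z (Sum.inr i) (Sum.inl j))
      = fun z => cotangentMetric h A (fun _ => b) z (Sum.inl j) (Sum.inr i) := fun i j => by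
    funext z; exact cotangentMetric_symm _ _ _ _ hh.symm _ _
  refine ⟨fun α β => ?_, ?_, fun z => cotangentMetric_symm _ _ _ _ hh.symm, fun γ α β => ?_⟩
  · rcases α with i | i <;> rcases β with j | j
    · exact (hh.hasJet_cotangentMetric_inl_inl hA b i j).smooth
    · exact (hh.hasJet_cotangentMetric_inl_inr hA b i j).smooth
    · rw [hsymm]; exact (hh.hasJet_cotangentMetric_inl_inr hA b j i).smooth
    · exact (hh.hasJet_cotangentMetric_inr_inr hA b i j).smooth
  · rw [hh.cotangentMetric_zeroPoint hA b, Matrix.det_diagonal, isUnit_iff_ne_zero,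
      Finset.prod_ne_zero_iff]
    rintro (i | i) _ <;> simp [hA]
  · rcases α with i | i <;> rcases β with j | j
    · exact (hh.hasJet_cotangentMetric_inl_inl hA b i j).first γ
    · exact (hh.hasJet_cotangentMetric_inl_inr hA b i j).first γ
    · rw [hsymm]; exact (hh.hasJet_cotangentMetric_inl_inr hA b j i).first γ
    · exact (hh.hasJet_cotangentMetric_inr_inr hA b i j).first γ

end IsNormalAt

/-! ### Holomorphic sectional curvature on the zero section -/

section Curvature

variable {ι : Type*} [Fintype ι] [DecidableEq ι] {h : (ι → ℝ) → Matrix ι ι ℝ} {y : ι → ℝ}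

theorem hessForm_eq_nested {κ : Type*} [Fintype κ] [DecidableEq κ]
    (h : (κ → ℝ) → Matrix κ κ ℝ) (y a b c d : κ → ℝ) :
    hessForm h y a b c d
      = ∑ i, (∑ j, (∑ k, (∑ l, hess h y i j k l * d l) * c k) * b j) * a i := by
  simp only [hessForm, Finset.sum_mul]
  refine Finset.sum_congr rfl fun i _ => Finset.sum_congr rfl fun j _ =>
    Finset.sum_congr rfl fun k _ => Finset.sum_congr rfl fun l _ => ?_
  ring

theorem sum_mul_elim_single (F : ι ⊕ ι → ℝ) (a b : ι) (r s : ℝ) :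
    ∑ i, F i * (Sum.elim (Pi.single a r) (Pi.single b s) : ι ⊕ ι → ℝ) i
      = F (Sum.inl a) * r + F (Sum.inr b) * s := by
  simp [Pi.single_apply]

theorem hessForm_single (a b c d : ι) :
    hessForm h y (Pi.single a 1) (Pi.single b 1) (Pi.single c 1) (Pi.single d 1)
      = hess h y a b c d := by
  simp [hessForm_eq_nested, Pi.single_apply]

theorem gammaHess_inl_inl (i j k l : ι) :
    gammaHess h y i j (Sum.inl k) (Sum.inl l) = 0 := by
  simp [gammaHess]

theorem gammaHess_inr_inr (i j k l : ι) :
    gammaHess h y i j (Sum.inr k) (Sum.inr l) = 0 := by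
  simp [gammaHess]

theorem gammaHess_inl_inr (i j k m : ι) :
    gammaHess h y i j (Sum.inl m) (Sum.inr k)
      = (1 / 2 : ℝ) * (hess h y m i j k + hess h y m j i k - hess h y m k i j) := by
  simp [gammaHess, Pi.single_apply]

theorem gammaHess_inr_inl (i j k m : ι) :
    gammaHess h y i j (Sum.inr k) (Sum.inl m)
      = (1 / 2 : ℝ) * (hess h y m i j k + hess h y m j i k - hess h y m k i j) := by
  simp [gammaHess, Pi.single_apply]

namespace IsNormalAt

variable (hh : IsNormalAt h y)
include hh

/-- The curvature of the plane spanned by `∂/∂q^a` and `∂/∂q^b` in terms of the second derivatives of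
the metric. -/
theorem hess_of_sectionalCurvature {a b : ι} (hab : a ≠ b) {c : ℝ}
    (hc : sectionalCurvature h y (Pi.single a 1) (Pi.single b 1) = c) :
    hess h y a b a b - (1 / 2 : ℝ) * hess h y a a b b - (1 / 2 : ℝ) * hess h y b b a a = c := by
  rw [← hc, sectionalCurvature, hh.pairing_curvatureVec]
  simp only [hessForm_single, pairing, hh.eq_one]
  rw [hh.hess_symm a b b a]
  simp [Matrix.one_apply, Pi.single_apply, hab]

variable {A : ℝ} (hA : A ≠ 0) (v : ℝ)
include hA

theorem cotangentJ_zeroPoint (X : ι ⊕ ι → ℝ) :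
    cotangentJ h A (fun _ => v) (zeroPoint y) X
      = Sum.elim (fun k => -(1 / A) * X (Sum.inr k)) (fun k => A * X (Sum.inl k)) := by
  have hG : ∀ i j, lowerG h A (fun _ => v) (zeroPoint y) i j = A * (1 : Matrix ι ι ℝ) i j :=
    fun i j => (hh.hasJet_lowerG A v i j).value
  have hH : ∀ i j, upperH h A (fun _ => v) (zeroPoint y) i j = 1 / A * (1 : Matrix ι ι ℝ) i j :=
    fun i j => (hh.hasJet_upperH hA v i j).value
  have hΓ : ∀ i j, christoffelZero h (zeroPoint y) i j = 0 :=
    fun i j => (hh.hasJet_christoffelZero i j).value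
  funext α
  rcases α with k | k <;>
    simp [cotangentJ, hG, hH, absDiff, hΓ, horField, vertField, Finset.sum_apply, Pi.single_apply,
      Matrix.one_apply, mul_comm]

theorem hess_cotangentMetric_inl_inl (i j : ι) (α β : ι ⊕ ι) :
    hess (cotangentMetric h A fun _ => v) (zeroPoint y) α β (Sum.inl i) (Sum.inl j)
      = A * Sum.elim (fun k => Sum.elim (fun l => hess h y k l i j) 0 β) 0 α
        + v * momHess i j α β :=
  (hh.hasJet_cotangentMetric_inl_inl hA v i j).second α β

theorem hess_cotangentMetric_inl_inr (i j : ι) (α β : ι ⊕ ι) :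
    hess (cotangentMetric h A fun _ => v) (zeroPoint y) α β (Sum.inl i) (Sum.inr j)
      = -(1 / A * gammaHess h y j i α β) :=
  (hh.hasJet_cotangentMetric_inl_inr hA v i j).second α β

theorem hess_cotangentMetric_inr_inl (i j : ι) (α β : ι ⊕ ι) :
    hess (cotangentMetric h A fun _ => v) (zeroPoint y) α β (Sum.inr i) (Sum.inl j)
      = -(1 / A * gammaHess h y i j α β) := by
  rw [(hh.isFlatAt_cotangentMetric hA v).hess_symm, hh.hess_cotangentMetric_inl_inr hA]

theorem hess_cotangentMetric_inr_inr (i j : ι) (α β : ι ⊕ ι) :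
    hess (cotangentMetric h A fun _ => v) (zeroPoint y) α β (Sum.inr i) (Sum.inr j)
      = -(1 / A) * Sum.elim (fun k => Sum.elim (fun l => hess h y k l i j) 0 β) 0 α
        - v / A ^ 2 * momHess i j α β :=
  (hh.hasJet_cotangentMetric_inr_inr hA v i j).second α β

/-- The numerator of the holomorphic sectional curvature in the direction
`X = ∂/∂q^a + s ∂/∂p_b`, for which `Y = J X = A ∂/∂p_a - (s / A) ∂/∂q^b`. The second
derivatives of the metric of the base enter only through its curvature on the plane of `∂/∂q^a` and
`∂/∂q^b`. -/
theorem pairing_curvatureVec_cotangent {a b : ι} (hab : a ≠ b) (s : ℝ) {c : ℝ}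
    (hc : sectionalCurvature h y (Pi.single a 1) (Pi.single b 1) = c) {X Y : ι ⊕ ι → ℝ}
    (hX : X = Sum.elim (Pi.single a 1) (Pi.single b s))
    (hY : Y = Sum.elim (Pi.single b (-(s / A))) (Pi.single a A)) :
    pairing (cotangentMetric h A fun _ => -c / A) (zeroPoint y)
        (curvatureVec (cotangentMetric h A fun _ => -c / A) (zeroPoint y) X Y Y) X
      = c * A * (1 + 6 * (s / A) ^ 2 + (s / A) ^ 4) := by
  have hbase := hh.hess_of_sectionalCurvature hab hc
  rw [(hh.isFlatAt_cotangentMetric hA _).pairing_curvatureVec, hX, hY]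
  simp only [hessForm_eq_nested, sum_mul_elim_single, hh.hess_cotangentMetric_inl_inl hA,
    hh.hess_cotangentMetric_inl_inr hA, hh.hess_cotangentMetric_inr_inl hA,
    hh.hess_cotangentMetric_inr_inr hA, gammaHess_inl_inl, gammaHess_inr_inr, gammaHess_inl_inr,
    gammaHess_inr_inl, momHess, Sum.elim_inl, Sum.elim_inr, Pi.single_apply, reduceCtorEq,
    if_false, Sum.inr.injEq, hab, hab.symm, if_true, Pi.zero_apply, mul_zero, add_zero, zero_mul,
    mul_one, zero_add, neg_zero, sub_zero, one_mul]
  -- name all mixed derivatives of the mixed component of the metric `hess h y a b a b`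
  rw [hh.hess_comm b a, hh.hess_symm a b b a, hh.hess_comm b a, hh.hess_symm a b b a]
  field_simp
  linear_combination (16 * s ^ 2 * A ^ 2) * hbase

theorem holomorphicSectionalCurvature_zeroPoint {a b : ι} (hab : a ≠ b) (s : ℝ) {c : ℝ}
    (hc : sectionalCurvature h y (Pi.single a 1) (Pi.single b 1) = c) :
    holomorphicSectionalCurvature h A (fun _ => -c / A) (zeroPoint y)
        (Sum.elim (Pi.single a 1) (Pi.single b s))
      = c / A * ((1 + 6 * (s / A) ^ 2 + (s / A) ^ 4) / (1 + (s / A) ^ 2) ^ 2) := by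
  have hJ : cotangentJ h A (fun _ => -c / A) (zeroPoint y)
      (Sum.elim (Pi.single a 1) (Pi.single b s))
      = Sum.elim (Pi.single b (-(s / A))) (Pi.single a A) := by
    rw [hh.cotangentJ_zeroPoint hA]
    congr 1 <;> funext k <;> simp [Pi.single_apply, div_eq_inv_mul]
  have hp : ∀ U V, pairing (cotangentMetric h A fun _ => -c / A) (zeroPoint y) U V
      = ∑ α, (Sum.elim (fun _ => A) (fun _ => 1 / A) : ι ⊕ ι → ℝ) α * U α * V α := by
    intro U V
    rw [pairing]
    simp only [hh.cotangentMetric_zeroPoint hA, Matrix.diagonal_apply, ite_mul, zero_mul,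
      Finset.sum_ite_eq, Finset.mem_univ, if_true]
  rw [holomorphicSectionalCurvature, hJ, sectionalCurvature,
    hh.pairing_curvatureVec_cotangent hA hab s hc rfl rfl, hp, hp, hp]
  simp only [sum_mul_elim_single]
  simp [hab, hab.symm]
  have : 1 + (s / A) ^ 2 ≠ 0 := by positivity
  field_simp
  ring

end IsNormalAt
end Curvature

/-! ### The metric in charts -/

section Charts

variable {n : ℕ} {M : Type*} [TopologicalSpace M] [ChartedSpace (EuclideanSpace ℝ (Fin n)) M]
  [IsManifold (𝓡 n) ∞ M]

/-- The metric `g` in the chart `e`, as a function of a point and two vectors of `ℝⁿ`. -/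
def chartForm (g : SmoothMetric n M) (e : OpenPartialHomeomorph M (EuclideanSpace ℝ (Fin n)))
    (y u v : EuclideanSpace ℝ (Fin n)) : ℝ :=
  g.inner (e.symm y) (mfderiv (𝓡 n) (𝓡 n) e.symm y u) (mfderiv (𝓡 n) (𝓡 n) e.symm y v)

variable (g : SmoothMetric n M) {e : OpenPartialHomeomorph M (EuclideanSpace ℝ (Fin n))}

theorem chartMetric_apply (y : Fin n → ℝ) (i j : Fin n) :
    chartMetric g e y i j = chartForm g e (WithLp.toLp 2 y) (EuclideanSpace.single i 1)
      (EuclideanSpace.single j 1) := rfl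

theorem chartMetric_symm (y : Fin n → ℝ) (i j : Fin n) :
    chartMetric g e y i j = chartMetric g e y j i :=
  g.symm _ _ _

theorem contDiffAt_chartForm (he : e ∈ IsManifold.maximalAtlas (𝓡 n) ∞ M)
    {y : EuclideanSpace ℝ (Fin n)} (hy : y ∈ e.target) (u v : EuclideanSpace ℝ (Fin n)) :
    ContDiffAt ℝ ∞ (fun z => chartForm g e z u v) y := by
  have hsymm := contMDiffOn_symm_of_mem_maximalAtlas he
  have htan : ∀ w : EuclideanSpace ℝ (Fin n), ContMDiffAt (𝓡 n) ((𝓡 n).prod (𝓡 n)) ∞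
      (fun z => Bundle.TotalSpace.mk' (EuclideanSpace ℝ (Fin n)) (E := TangentSpace (𝓡 n)) (e.symm z)
        (mfderiv (𝓡 n) (𝓡 n) e.symm z w)) y := by
    intro w
    have h1 := hsymm.contMDiffOn_tangentMapWithin (m := ∞) (by simp)
      e.open_target.uniqueMDiffOn
    have h2 : ContMDiffAt (𝓡 n) ((𝓡 n).prod (𝓡 n)) ∞
        (fun z => Bundle.TotalSpace.mk' (EuclideanSpace ℝ (Fin n))
          (E := TangentSpace (𝓡 n) (M := EuclideanSpace ℝ (Fin n))) z w) y :=
      contMDiffAt_vectorSpace_iff_contDiffAt.2 contDiffAt_const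
    have h3 := (h1.contMDiffAt (x := Bundle.TotalSpace.mk' (EuclideanSpace ℝ (Fin n))
          (E := TangentSpace (𝓡 n) (M := EuclideanSpace ℝ (Fin n))) y w)
        ((e.open_target.preimage (FiberBundle.continuous_proj _ _)).mem_nhds hy)).comp y h2
    refine h3.congr_of_eventuallyEq ?_
    filter_upwards [e.open_target.mem_nhds hy] with z hz
    simp only [Function.comp, tangentMapWithin]
    rw [mfderivWithin_of_isOpen e.open_target hz]
  have hb : ContMDiffAt (𝓡 n) (𝓡 n) ∞ e.symm y := hsymm.contMDiffAt (e.open_target.mem_nhds hy)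
  have key := ContMDiffAt.clm_bundle_apply₂ (F₁ := EuclideanSpace ℝ (Fin n))
    (F₂ := EuclideanSpace ℝ (Fin n)) (F₃ := ℝ) (E₃ := Bundle.Trivial M ℝ)
    (g.contMDiff.contMDiffAt.comp y hb) (htan u) (htan v)
  simp only [Bundle.contMDiffAt_totalSpace] at key
  exact contMDiffAt_iff_contDiffAt.1 key.2

theorem contDiffAt_chartMetric (he : e ∈ IsManifold.maximalAtlas (𝓡 n) ∞ M)
    {y : Fin n → ℝ} (hy : WithLp.toLp 2 y ∈ e.target) (i j : Fin n) :
    ContDiffAt ℝ ∞ (fun z => chartMetric g e z i j) y :=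
  ContDiffAt.comp y (g := fun z => chartForm g e z _ _) (f := fun z => WithLp.toLp 2 z)
    (contDiffAt_chartForm g he hy _ _) (PiLp.contDiff_toLp).contDiffAt

theorem mdifferentiable_of_mem_maximalAtlas (he : e ∈ IsManifold.maximalAtlas (𝓡 n) ∞ M) :
    e.MDifferentiable (𝓡 n) (𝓡 n) :=
  ⟨(contMDiffOn_of_mem_maximalAtlas he).mdifferentiableOn (by simp),
    (contMDiffOn_symm_of_mem_maximalAtlas he).mdifferentiableOn (by simp)⟩

theorem chartForm_pos (he : e ∈ IsManifold.maximalAtlas (𝓡 n) ∞ M)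
    {y u : EuclideanSpace ℝ (Fin n)} (hy : y ∈ e.target) (hu : u ≠ 0) :
    0 < chartForm g e y u u := by
  refine g.pos _ _ fun h0 => hu ?_
  have hinj := (mdifferentiable_of_mem_maximalAtlas he).symm.mfderiv_injective (x := y) hy
  exact hinj (h0.trans (map_zero _).symm)

theorem chartForm_eq_sum (y u v : EuclideanSpace ℝ (Fin n)) :
    chartForm g e y u v = ∑ a, ∑ b, u a * v b * chartMetric g e (WithLp.ofLp y) a b := by
  have hsum : ∀ w : EuclideanSpace ℝ (Fin n),
      w = ∑ a, w a • EuclideanSpace.single a (1 : ℝ) := by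
    intro w
    ext b
    simp [Pi.single_apply]
  have hbil : ∃ β : EuclideanSpace ℝ (Fin n) →ₗ[ℝ] EuclideanSpace ℝ (Fin n) →ₗ[ℝ] ℝ,
      ∀ u v, chartForm g e y u v = β u v := by
    let D : EuclideanSpace ℝ (Fin n) →L[ℝ] EuclideanSpace ℝ (Fin n) :=
      mfderiv (𝓡 n) (𝓡 n) e.symm y
    let G : EuclideanSpace ℝ (Fin n) →L[ℝ] EuclideanSpace ℝ (Fin n) →L[ℝ] ℝ := g.inner (e.symm y)
    exact ⟨LinearMap.mk₂ ℝ (fun u v => G (D u) (D v)) (by simp) (by simp) (by simp) (by simp),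
      fun _ _ => rfl⟩
  obtain ⟨β, hβ⟩ := hbil
  simp only [chartMetric_apply, WithLp.toLp_ofLp, hβ]
  conv_lhs => rw [hsum u, hsum v]
  simp only [map_sum, map_smul, LinearMap.sum_apply, LinearMap.smul_apply, smul_eq_mul,
    Finset.mul_sum]
  rw [Finset.sum_comm]
  refine Finset.sum_congr rfl fun a _ => Finset.sum_congr rfl fun b _ => ?_
  ring

theorem posDef_chartMetric (he : e ∈ IsManifold.maximalAtlas (𝓡 n) ∞ M)
    {y : Fin n → ℝ} (hy : WithLp.toLp 2 y ∈ e.target) : (chartMetric g e y).PosDef := by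
  refine Matrix.PosDef.of_dotProduct_mulVec_pos ?_ fun x hx => ?_
  · ext i j
    exact chartMetric_symm g y j i
  · have h := chartForm_pos g he hy (u := WithLp.toLp 2 x) (by simpa using hx)
    rw [chartForm_eq_sum] at h
    refine h.trans_eq ?_
    simp only [dotProduct, Matrix.mulVec, Finset.mul_sum, Pi.star_apply, star_trivial]
    refine Finset.sum_congr rfl fun a _ => Finset.sum_congr rfl fun b _ => ?_
    ring

/-- Change of chart: if `φ` is smooth with invertible derivative at `y`, then `φ` can be used, near
`y`, to reparametrize the chart `e`, and the components of the metric change by the rule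
`h_{ij} = ∂_i φ^a ∂_j φ^b g_{ab}`. -/
theorem exists_chart_pullback (he : e ∈ IsManifold.maximalAtlas (𝓡 n) ∞ M)
    {φ : (Fin n → ℝ) → (Fin n → ℝ)} (hφ : ContDiff ℝ ∞ φ) {y : Fin n → ℝ}
    {L : (Fin n → ℝ) ≃L[ℝ] (Fin n → ℝ)}
    (hL : HasFDerivAt φ (L : (Fin n → ℝ) →L[ℝ] (Fin n → ℝ)) y)
    (hy : WithLp.toLp 2 (φ y) ∈ e.target) :
    ∃ e' ∈ IsManifold.maximalAtlas (𝓡 n) ∞ M, WithLp.toLp 2 y ∈ e'.target ∧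
      e'.symm (WithLp.toLp 2 y) = e.symm (WithLp.toLp 2 (φ y)) ∧
      ∀ z, WithLp.toLp 2 z ∈ e'.target → ∀ i j, chartMetric g e' z i j
        = ∑ a, ∑ b, partialDeriv i (fun w => φ w a) z * partialDeriv j (fun w => φ w b) z
          * chartMetric g e (φ z) a b := by
  let T : EuclideanSpace ℝ (Fin n) ≃L[ℝ] (Fin n → ℝ) := PiLp.continuousLinearEquiv 2 ℝ _
  let ψ : EuclideanSpace ℝ (Fin n) → EuclideanSpace ℝ (Fin n) := fun z => T.symm (φ (T z))
  have hψ : ContDiff ℝ ∞ ψ := T.symm.contDiff.comp (hφ.comp T.contDiff)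
  have hdψ : ∀ z, HasFDerivAt ψ
      ((T.symm : (Fin n → ℝ) →L[ℝ] EuclideanSpace ℝ (Fin n)).comp
        ((fderiv ℝ φ (T z)).comp (T : EuclideanSpace ℝ (Fin n) →L[ℝ] (Fin n → ℝ)))) z := fun z =>
    T.symm.hasFDerivAt.comp z
      (((hφ.differentiable (by simp)) (T z)).hasFDerivAt.comp z T.hasFDerivAt)
  have hψ0 : HasFDerivAt ψ (((T.trans L).trans T.symm :
      EuclideanSpace ℝ (Fin n) ≃L[ℝ] EuclideanSpace ℝ (Fin n)) :
      EuclideanSpace ℝ (Fin n) →L[ℝ] EuclideanSpace ℝ (Fin n)) (T.symm y) := by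
    have := hdψ (T.symm y)
    rw [T.apply_symm_apply, hL.fderiv] at this
    exact this
  -- the inverse function theorem, on the open set where the derivative is invertible
  let Ψ := (hψ.contDiffAt (x := T.symm y)).toOpenPartialHomeomorph ψ hψ0 (by simp)
  let U : Set (EuclideanSpace ℝ (Fin n)) := fderiv ℝ ψ ⁻¹' Set.range
    ((↑) : (EuclideanSpace ℝ (Fin n) ≃L[ℝ] EuclideanSpace ℝ (Fin n)) →
      EuclideanSpace ℝ (Fin n) →L[ℝ] EuclideanSpace ℝ (Fin n))
  have hU : IsOpen U :=
    (ContinuousLinearEquiv.isOpen).preimage (hψ.continuous_fderiv (by simp))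
  let Φ := Ψ.restrOpen U hU
  have hΦsource : Φ.source = Ψ.source ∩ U := rfl
  have hΦ : ∀ z, Φ z = ψ z := fun _ => rfl
  have hΦsymm : ContDiffOn ℝ ∞ Φ.symm Φ.target := by
    intro z hz
    obtain ⟨K, hK⟩ := (Φ.map_target hz).2
    refine (Φ.contDiffAt_symm (f₀' := K) hz ?_ hψ.contDiffAt).contDiffWithinAt
    rw [hK]
    exact ((hψ.differentiable (by simp)) _).hasFDerivAt
  have hyU : T.symm y ∈ Φ.source :=
    ⟨ContDiffAt.mem_toOpenPartialHomeomorph_source _ _ _, ⟨_, hψ0.fderiv.symm⟩⟩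
  let e' := e.trans Φ.symm
  have hsymm : ∀ z, e'.symm z = e.symm (ψ z) := fun _ => rfl
  have htarget : ∀ z, z ∈ e'.target ↔ z ∈ Φ.source ∧ ψ z ∈ e.target := by
    intro z
    change z ∈ (e.trans Φ.symm).target ↔ _
    rw [OpenPartialHomeomorph.trans_target]
    rfl
  refine ⟨e', ?_, (htarget _).2 ⟨hyU, hy⟩, rfl, ?_⟩
  · refine (IsManifold.mem_maximalAtlas_iff_contMDiffOn e').2 ⟨?_, ?_⟩
    · refine hΦsymm.contMDiffOn.comp ((contMDiffOn_of_mem_maximalAtlas he).mono ?_) ?_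
      · intro x hx
        exact hx.1
      · intro x hx
        exact hx.2
    · refine (contMDiffOn_symm_of_mem_maximalAtlas he).comp (hψ.contMDiff.contMDiffOn) ?_
      intro z hz
      exact ((htarget z).1 hz).2
  · intro z hz i j
    have hz' : ψ (WithLp.toLp 2 z) ∈ e.target := ((htarget _).1 hz).2
    have hde : ∀ u, mfderiv (𝓡 n) (𝓡 n) e'.symm (WithLp.toLp 2 z) u
        = mfderiv (𝓡 n) (𝓡 n) e.symm (ψ (WithLp.toLp 2 z))
          (fderiv ℝ ψ (WithLp.toLp 2 z) u) := by
      intro u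
      have h1 : MDifferentiableAt (𝓡 n) (𝓡 n) e.symm (ψ (WithLp.toLp 2 z)) :=
        (mdifferentiable_of_mem_maximalAtlas he).symm.mdifferentiableAt hz'
      have h2 : MDifferentiableAt (𝓡 n) (𝓡 n) ψ (WithLp.toLp 2 z) :=
        ((hψ.differentiable (by simp)) _).mdifferentiableAt
      have h3 := mfderiv_comp (WithLp.toLp 2 z) h1 h2
      rw [mfderiv_eq_fderiv] at h3
      exact congrArg (fun D => D u) h3
    have hform : ∀ u v, chartForm g e' (WithLp.toLp 2 z) u v
        = chartForm g e (ψ (WithLp.toLp 2 z)) (fderiv ℝ ψ (WithLp.toLp 2 z) u)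
          (fderiv ℝ ψ (WithLp.toLp 2 z) v) := by
      intro u v
      unfold chartForm
      rw [hde u, hde v]
      rfl
    have hcomp : ∀ k a, fderiv ℝ ψ (WithLp.toLp 2 z) (EuclideanSpace.single k 1) a
        = partialDeriv k (fun w => φ w a) z := by
      intro k a
      rw [(hdψ _).fderiv, partialDeriv]
      have := (hasFDerivAt_pi'.1 ((hφ.differentiable (by simp)) z).hasFDerivAt a).fderiv
      rw [this]
      rfl
    rw [chartMetric_apply, hform, chartForm_eq_sum]
    simp only [hcomp]
    rfl

end Charts

/-! ### Charts adapted to a point -/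

section NormalChart

variable {n : ℕ}

open scoped MatrixOrder Matrix.Norms.L2Operator in
theorem exists_transpose_mul_mul_eq_one {S : Matrix (Fin n) (Fin n) ℝ} (hS : S.PosDef) :
    ∃ N : Matrix (Fin n) (Fin n) ℝ, IsUnit N ∧ N.transpose * S * N = 1 := by
  obtain ⟨Y, hY, rfl⟩ := CStarAlgebra.isStrictlyPositive_iff_eq_star_mul_self.mp
    hS.isStrictlyPositive
  have hdet : IsUnit Y.det := (Matrix.isUnit_iff_isUnit_det Y).1 hY
  refine ⟨Y⁻¹, (Matrix.isUnit_nonsing_inv_iff).2 hY, ?_⟩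
  have hstar : star Y = Y.transpose := by
    ext i j; simp [Matrix.star_apply]
  rw [hstar, Matrix.transpose_nonsing_inv, ← mul_assoc, mul_assoc,
    Matrix.nonsing_inv_mul _ (by rwa [Matrix.det_transpose]), one_mul, Matrix.mul_nonsing_inv _ hdet]

theorem christoffel_symm {h : (Fin n → ℝ) → Matrix (Fin n) (Fin n) ℝ}
    (hsymm : ∀ z i j, h z i j = h z j i) (y : Fin n → ℝ) (a b c : Fin n) :
    christoffel h y a b c = christoffel h y a c b := by
  have : (fun z => h z b c) = fun z => h z c b := funext fun z => hsymm z b c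
  simp only [christoffel]
  congr 1
  refine Finset.sum_congr rfl fun l _ => ?_
  rw [this]; ring

/-- The quadratic change of coordinates `y^a ↦ y^a - ½ C^a_{bc} y^b y^c`. -/
def quadraticMap (C : Fin n → Fin n → Fin n → ℝ) (y : Fin n → ℝ) : Fin n → ℝ :=
  fun a => y a - (1 / 2 : ℝ) * ∑ b, ∑ c, C a b c * (y b * y c)

theorem contDiff_quadraticMap (C : Fin n → Fin n → Fin n → ℝ) : ContDiff ℝ ∞ (quadraticMap C) := by
  unfold quadraticMap
  fun_prop

theorem quadraticMap_zero (C : Fin n → Fin n → Fin n → ℝ) : quadraticMap C 0 = 0 := by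
  funext a; simp [quadraticMap]

theorem partialDeriv_coord (a i : Fin n) (y : Fin n → ℝ) :
    partialDeriv i (fun z => z a) y = (1 : Matrix (Fin n) (Fin n) ℝ) a i := by
  have : HasFDerivAt (fun z : Fin n → ℝ => z a)
    (ContinuousLinearMap.proj (R := ℝ) (φ := fun _ : Fin n => ℝ) a) y :=
    (ContinuousLinearMap.proj (R := ℝ) (φ := fun _ : Fin n => ℝ) a).hasFDerivAt
  rw [partialDeriv, this.fderiv, ContinuousLinearMap.proj_apply, Matrix.one_apply, Pi.single_apply]

theorem partialDeriv_quadraticMap {C : Fin n → Fin n → Fin n → ℝ}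
    (hC : ∀ a b c, C a b c = C a c b) (a i : Fin n) (y : Fin n → ℝ) :
    partialDeriv i (fun z => quadraticMap C z a) y
      = (1 : Matrix (Fin n) (Fin n) ℝ) a i - ∑ b, C a b i * y b := by
  have d : ∀ b, DifferentiableAt ℝ (fun z : Fin n → ℝ => z b) y := fun b => by fun_prop
  unfold quadraticMap
  rw [partialDeriv_sub (d a) (by fun_prop), partialDeriv_const_mul (by fun_prop),
    partialDeriv_sum _ (fun b _ => by fun_prop)]
  have h1 : ∀ b, partialDeriv i (fun z : Fin n → ℝ => ∑ c, C a b c * (z b * z c)) y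
      = (C a b i * y b) + ∑ c, (1 : Matrix (Fin n) (Fin n) ℝ) b i * (C a b c * y c) := by
    intro b
    rw [partialDeriv_sum _ (fun c _ => by fun_prop)]
    simp only [fun c => partialDeriv_const_mul ((d b).fun_mul (d c)) (C a b c) i,
      fun c => partialDeriv_mul (d b) (d c) i, partialDeriv_coord, mul_add,
      Finset.sum_add_distrib]
    congr 1
    · simp [Matrix.one_apply]
    · exact Finset.sum_congr rfl fun c _ => by ring
  simp only [h1, Finset.sum_add_distrib, ← Finset.mul_sum]
  rw [partialDeriv_coord]
  simp only [Matrix.one_apply, ite_mul, one_mul, zero_mul, Finset.sum_ite_eq',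
    Finset.mem_univ, if_true, hC a i]
  ring

theorem hasFDerivAt_quadraticMap {C : Fin n → Fin n → Fin n → ℝ}
    (hC : ∀ a b c, C a b c = C a c b) :
    HasFDerivAt (quadraticMap C) (ContinuousLinearMap.id ℝ (Fin n → ℝ)) 0 := by
  have h := ((contDiff_quadraticMap C).differentiable (by simp) 0).hasFDerivAt
  suffices hD : fderiv ℝ (quadraticMap C) 0 = ContinuousLinearMap.id ℝ (Fin n → ℝ) by rwa [hD] at h
  refine ContinuousLinearMap.coe_injective (LinearMap.pi_ext' fun i => LinearMap.ext_ring ?_)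
  funext a
  have h1 := (hasFDerivAt_pi'.1 h a).fderiv
  have h2 := partialDeriv_quadraticMap hC a i 0
  rw [partialDeriv, h1] at h2
  simpa [Matrix.one_apply, Pi.single_apply] using h2

/-- If `h` agrees with the Euclidean metric at `0`, its pullback by the quadratic map with the
Christoffel symbols of `h` at `0` as coefficients agrees with the Euclidean metric to first order. -/
theorem isNormalAt_of_pullback {h h' : (Fin n → ℝ) → Matrix (Fin n) (Fin n) ℝ}
    (hs : ∀ i j, ContDiffAt ℝ ∞ (fun z => h z i j) 0) (h0 : h 0 = 1)
    (hsymm : ∀ z i j, h z i j = h z j i) (hs' : ∀ i j, ContDiffAt ℝ ∞ (fun z => h' z i j) 0)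
    (hsymm' : ∀ z i j, h' z i j = h' z j i)
    (hpull : ∀ᶠ z in 𝓝 0, ∀ i j, h' z i j
      = ∑ a, ∑ b, partialDeriv i (fun w => quadraticMap (christoffel h 0) w a) z
        * partialDeriv j (fun w => quadraticMap (christoffel h 0) w b) z
        * h (quadraticMap (christoffel h 0) z) a b) :
    IsNormalAt h' 0 := by
  have hfsymm : ∀ i j, (fun z => h z i j) = fun z => h z j i := fun i j =>
    funext fun z => hsymm z i j
  have hC := christoffel_symm hsymm 0
  -- metric compatibility of the Christoffel symbols at a point where the metric is Euclidean
  have hcompat : ∀ k i j, partialDeriv k (fun z => h z i j) 0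
      = christoffel h 0 i k j + christoffel h 0 j k i := by
    intro k i j
    simp only [christoffel, h0, inv_one, Matrix.one_apply, ite_mul, one_mul, zero_mul,
      Finset.sum_ite_eq, Finset.mem_univ, if_true]
    rw [hfsymm j i]; ring
  set C := christoffel h 0
  simp only [partialDeriv_quadraticMap hC] at hpull
  have hval : h' 0 = 1 := by
    ext i j
    rw [hpull.self_of_nhds i j]
    simp [quadraticMap_zero, h0, Matrix.one_apply, eq_comm]
  refine ⟨⟨hs', by simp [hval], hsymm', fun k i j => ?_⟩, hval⟩
  have hev : (fun z => h' z i j) =ᶠ[𝓝 0] fun z => ∑ a, ∑ b,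
      ((1 : Matrix (Fin n) (Fin n) ℝ) a i - ∑ c, C a c i * z c) *
        ((1 : Matrix (Fin n) (Fin n) ℝ) b j - ∑ c, C b c j * z c) * h (quadraticMap C z) a b := by
    filter_upwards [hpull] with z hz using hz i j
  have hP : ∀ a i, DifferentiableAt ℝ
      (fun z : Fin n → ℝ => (1 : Matrix (Fin n) (Fin n) ℝ) a i - ∑ c, C a c i * z c) 0 :=
    fun a i => by fun_prop
  have hPd : ∀ a i, partialDeriv k
      (fun z : Fin n → ℝ => (1 : Matrix (Fin n) (Fin n) ℝ) a i - ∑ c, C a c i * z c) 0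
      = - C a k i := by
    intro a i
    rw [partialDeriv_sub (by fun_prop) (by fun_prop), partialDeriv_const,
      partialDeriv_sum _ (fun c _ => by fun_prop)]
    simp only [fun c => partialDeriv_const_mul (y := (0 : Fin n → ℝ))
      (f := fun z : Fin n → ℝ => z c) (by fun_prop) (C a c i) k, partialDeriv_coord]
    simp [Matrix.one_apply]
  have hcomp : ∀ a b, HasFDerivAt (fun z => h (quadraticMap C z) a b)
      (fderiv ℝ (fun z => h z a b) 0) 0 := by
    intro a b
    have h1 : HasFDerivAt (fun z => h z a b) (fderiv ℝ (fun z => h z a b) 0) (quadraticMap C 0) := by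
      rw [quadraticMap_zero]
      exact ((hs a b).differentiableAt (by simp)).hasFDerivAt
    exact h1.comp 0 (hasFDerivAt_quadraticMap hC)
  have hcompd : ∀ a b, partialDeriv k (fun z => h (quadraticMap C z) a b) 0
      = C a k b + C b k a := by
    intro a b
    rw [← hcompat, partialDeriv, (hcomp a b).fderiv, partialDeriv]
  rw [(partialDeriv_congr hev k).eq_of_nhds]
  have hd := fun a b => ((hP a i).fun_mul (hP b j)).fun_mul (hcomp a b).differentiableAt
  rw [partialDeriv_sum _ fun a _ => DifferentiableAt.fun_sum fun b _ => hd a b]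
  have hterm : ∀ a b, partialDeriv k (fun z : Fin n → ℝ =>
      ((1 : Matrix (Fin n) (Fin n) ℝ) a i - ∑ c, C a c i * z c) *
        ((1 : Matrix (Fin n) (Fin n) ℝ) b j - ∑ c, C b c j * z c) * h (quadraticMap C z) a b) 0
      = (1 : Matrix (Fin n) (Fin n) ℝ) a i * (1 : Matrix (Fin n) (Fin n) ℝ) b j
          * (C a k b + C b k a)
        - (1 : Matrix (Fin n) (Fin n) ℝ) a i * (1 : Matrix (Fin n) (Fin n) ℝ) a b * C b k j
        - (1 : Matrix (Fin n) (Fin n) ℝ) b j * (1 : Matrix (Fin n) (Fin n) ℝ) a b * C a k i := by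
    intro a b
    rw [partialDeriv_mul ((hP a i).fun_mul (hP b j)) (hcomp a b).differentiableAt,
      partialDeriv_mul (hP a i) (hP b j), hPd, hPd, hcompd, quadraticMap_zero, h0]
    simp
    ring
  simp only [fun a => partialDeriv_sum Finset.univ (fun b _ => hd a b) k, hterm]
  simp [Matrix.one_apply, Finset.sum_sub_distrib]

variable {M : Type*} [TopologicalSpace M] [ChartedSpace (EuclideanSpace ℝ (Fin n)) M]
  [IsManifold (𝓡 n) ∞ M] (g : SmoothMetric n M)

/-- Around every point there is a chart, centred at the point, in which the metric agrees with the
Euclidean metric to first order. -/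
theorem exists_isNormalAt (x : M) :
    ∃ e ∈ IsManifold.maximalAtlas (𝓡 n) ∞ M, x ∈ e.source ∧ e x = 0 ∧
      IsNormalAt (chartMetric g e) 0 := by
  -- an affine change of coordinates makes the metric Euclidean at the point
  set e₀ := chartAt (EuclideanSpace ℝ (Fin n)) x
  have he₀ : e₀ ∈ IsManifold.maximalAtlas (𝓡 n) ∞ M := IsManifold.chart_mem_maximalAtlas x
  have hx₀ : x ∈ e₀.source := mem_chart_source _ x
  have hy₀ : WithLp.toLp 2 (WithLp.ofLp (e₀ x)) ∈ e₀.target := e₀.map_source hx₀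
  obtain ⟨N, hN, hNS⟩ := exists_transpose_mul_mul_eq_one (posDef_chartMetric g he₀ hy₀)
  let K : (Fin n → ℝ) ≃L[ℝ] (Fin n → ℝ) :=
    (Matrix.toLinearEquiv' N (Matrix.invertibleOfIsUnitDet N
      ((Matrix.isUnit_iff_isUnit_det N).1 hN))).toContinuousLinearEquiv
  have hK : ∀ u, K u = N.mulVec u := fun u => rfl
  let φ : (Fin n → ℝ) → (Fin n → ℝ) := fun y => WithLp.ofLp (e₀ x) + K y
  have hφ : ContDiff ℝ ∞ φ := contDiff_const.add K.contDiff
  have hdφ : ∀ y, HasFDerivAt φ (K : (Fin n → ℝ) →L[ℝ] (Fin n → ℝ)) y := fun y =>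
    K.hasFDerivAt.const_add _
  have hφ0 : φ 0 = WithLp.ofLp (e₀ x) := by simp [φ]
  have hpφ : ∀ y i a, partialDeriv i (fun w => φ w a) y = N a i := by
    intro y i a
    rw [partialDeriv, (hasFDerivAt_pi'.1 (hdφ y) a).fderiv]
    change K (Pi.single i 1) a = _
    rw [hK]
    simp
  obtain ⟨e₁, he₁, ht₁, hs₁, hp₁⟩ := exists_chart_pullback g he₀ hφ (hdφ 0)
    (by rw [hφ0]; exact hy₀)
  have hone : chartMetric g e₁ 0 = 1 := by
    rw [← hNS]
    ext i j
    rw [hp₁ 0 ht₁ i j, hφ0]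
    simp only [hpφ, Matrix.mul_apply, Matrix.transpose_apply, Finset.sum_mul]
    rw [Finset.sum_comm]
    refine Finset.sum_congr rfl fun a _ => Finset.sum_congr rfl fun b _ => ?_
    ring
  -- a quadratic change of coordinates removes the first derivatives
  have hsymm : ∀ (e : OpenPartialHomeomorph M (EuclideanSpace ℝ (Fin n))) z i j,
      chartMetric g e z i j = chartMetric g e z j i := fun e z i j => chartMetric_symm g z i j
  set C := christoffel (chartMetric g e₁) 0
  have hC : ∀ a b c, C a b c = C a c b := christoffel_symm (hsymm e₁) 0
  obtain ⟨e₂, he₂, ht₂, hs₂, hp₂⟩ := exists_chart_pullback g he₁ (contDiff_quadraticMap C)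
    (y := 0) (L := ContinuousLinearEquiv.refl ℝ _) (hasFDerivAt_quadraticMap hC)
    (by rw [quadraticMap_zero]; exact ht₁)
  have hx : e₂.symm 0 = x := by
    have h2 : e₂.symm (WithLp.toLp 2 0) = x := by
      rw [hs₂, quadraticMap_zero, hs₁, hφ0]
      exact e₀.left_inv hx₀
    exact h2
  refine ⟨e₂, he₂, ?_, ?_, ?_⟩
  · rw [← hx]; exact e₂.map_target ht₂
  · rw [← hx]; exact e₂.right_inv ht₂
  · refine isNormalAt_of_pullback (contDiffAt_chartMetric g he₁ ht₁ · ·) hone (hsymm e₁)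
      (contDiffAt_chartMetric g he₂ ht₂ · ·) (hsymm e₂) ?_
    have hnhds : ∀ᶠ z : Fin n → ℝ in 𝓝 0, WithLp.toLp 2 z ∈ e₂.target :=
      (PiLp.continuous_toLp 2 (fun _ : Fin n => ℝ)).continuousAt.eventually
        (e₂.open_target.mem_nhds ht₂)
    filter_upwards [hnhds] with z hz using hp₂ z hz

end NormalChart

/-! ### Non-constancy of the holomorphic sectional curvature -/

section Main

variable {n : ℕ} {M : Type*} [TopologicalSpace M] [ChartedSpace (EuclideanSpace ℝ (Fin n)) M]
  [IsManifold (𝓡 n) ∞ M]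

/-- Constancy fails as soon as the domain contains a point of the zero section: there, in the
directions `∂/∂q^1` and `∂/∂q^1 + A ∂/∂p_2`, the holomorphic sectional curvature is `c / A` and
`2 c / A`. -/
theorem not_hasConstantHolomorphicSectionalCurvature (hn : 2 ≤ n) (g : SmoothMetric n M) {c A : ℝ}
    (hA : A ≠ 0) (hc : c ≠ 0) (hg : HasConstantSectionalCurvature g c) {U : Set (Cotangent n M)}
    (x : M) (hx : (⟨x, 0⟩ : Cotangent n M) ∈ U) :
    ¬ HasConstantHolomorphicSectionalCurvature g A (fun _ => -c / A) U := by
  rintro ⟨k, hk⟩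
  obtain ⟨e, he, hxe, hex, hnorm⟩ := exists_isNormalAt g x
  have hcoord : inducedCoord e (⟨x, 0⟩ : Cotangent n M) = zeroPoint 0 := by
    funext α
    rcases α with i | i
    · change e x i = 0
      rw [hex]; rfl
    · rfl
  let a : Fin n := ⟨0, by omega⟩
  let b : Fin n := ⟨1, by omega⟩
  have hab : a ≠ b := by simp [a, b]
  have hli : LinearIndependent ℝ ![(Pi.single a 1 : Fin n → ℝ), Pi.single b 1] := by
    rw [LinearIndependent.pair_iff]
    intro s t hst
    have h1 := congrFun hst a
    have h2 := congrFun hst b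
    simp [hab, hab.symm] at h1 h2
    exact ⟨h1, h2⟩
  have hsec : sectionalCurvature (chartMetric g e) 0 (Pi.single a 1) (Pi.single b 1) = c := by
    have := hg x e he hxe _ _ hli
    rwa [hex] at this
  -- the value in the direction `∂/∂q^a + s ∂/∂p_b`; it is `c / A` for `s = 0`, `2 c / A` for `s = A`
  have hval : ∀ s : ℝ, c / A * ((1 + 6 * (s / A) ^ 2 + (s / A) ^ 4) / (1 + (s / A) ^ 2) ^ 2)
      = k := by
    intro s
    rw [← hnorm.holomorphicSectionalCurvature_zeroPoint hA hab s hsec, ← hcoord]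
    refine hk _ hx e he hxe _ fun h0 => ?_
    have := congrFun h0 (Sum.inl a)
    simp at this
  have h0 := hval 0
  have h1 := hval A
  rw [div_self hA] at h1
  have hcA : c / A ≠ 0 := div_ne_zero hc hA
  norm_num at h0 h1
  exact hcA (by linarith)

theorem zero_mem_tube (g : SmoothMetric n M) {A c : ℝ} (hA : 0 < A) (hc : 0 < c) (x : M) :
    (⟨x, 0⟩ : Cotangent n M) ∈ tube g A c := by
  have : coNormSq g (⟨x, 0⟩ : Cotangent n M) = 0 := rfl
  change coNormSq g _ < _
  rw [this]
  positivity

end Main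

end CotangentKahler

end

open CotangentKahler in
theorem mainTheorem3 (n : ℕ) (hn : 2 ≤ n) (M : Type*) [TopologicalSpace M]
    [ChartedSpace (EuclideanSpace ℝ (Fin n)) M] [IsManifold (𝓡 n) ∞ M] [Nonempty M]
    (g : SmoothMetric n M) (c A : ℝ) (hA : 0 < A) (hg : HasConstantSectionalCurvature g c) :
    (c < 0 → ¬ HasConstantHolomorphicSectionalCurvature g A (fun _ => -c / A) Set.univ) ∧
    (0 < c → ¬ HasConstantHolomorphicSectionalCurvature g A (fun _ => -c / A) (tube g A c)) := by
  obtain ⟨x⟩ := ‹Nonempty M›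
  exact ⟨fun hc => not_hasConstantHolomorphicSectionalCurvature hn g hA.ne' hc.ne hg x trivial,
    fun hc => not_hasConstantHolomorphicSectionalCurvature hn g hA.ne' hc.ne' hg x
      (zero_mem_tube g hA hc x)⟩
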